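/- Morphisms are composed from left to right. A \emph{category with subobjects} is a small category $\mathcal C$ whose object set $v\mathcal C$ carries a partial order $\subseteq$, together with a monomorphism $j_a^b\colon a\to b$ (an \emph{inclusion}) for each $a\subseteq b$, such that $j_a^a=1_a$, $j_a^bj_b^c=j_a^c$, and if $h\,j_b^c=j_a^c$ for some $h\colon a\to b$, then $a\subseteq b$ and $h=j_a^b$. A \emph{retraction} is a right inverse of an inclusion; a \emph{bimorphism} is a morphism that is both mono and epi. A \emph{consistent} (resp. \emph{normal}) \emph{factorisation} of $f$ is $f=quj$ with $q$ a retraction, $u$ a bimorphism (resp. isomorphism) and $j$ an inclusion; $f^\circ=qu$ is the epimorphic component of $f$ and its codomain is $\operatorname{im}f$. For an object $c$, $\langle c\rangle$ is the category whose objects are the subobjects of $c$ and whose morphisms are generated by the inclusions and retractions among them. A bimorphism $u\colon c\to d$ is \emph{consistent} if there is a unique isomorphism of categories $T\colon\langle c\rangle\to\langle d\rangle$ such that $T(c')=\operatorname{im}(j_{c'}^cu)$ for $c'\subseteq c$, $T(j_{c'}^{c''})=j_{T(c')}^{T(c'')}$ for $c'\subseteq c''\subseteq c$, and the morphisms $(j_{c'}^cu)^\circ\colon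 c'\to T(c')$ are natural in $c'\in\langle c\rangle$. A \emph{consistent cone} $\gamma$ with vertex $c_\gamma$ is a family $\gamma(a)\colon a\to c_\gamma$ $(a\in v\mathcal C)$ with $j_a^b\gamma(b)=\gamma(a)$ whenever $a\subseteq b$, at least one $\gamma(a)$ being a bimorphism. A category with subobjects is a \emph{consistent category} if every inclusion has a right inverse; every morphism has a consistent factorisation; every bimorphism is consistent; every composite $jq$ of an inclusion $j$ and a retraction $q$ has a normal factorisation; and for every object $c$ there is a consistent cone $\epsilon$ with vertex $c$ and $\epsilon(c)=1_c$. An isomorphism of consistent categories is an isomorphism of categories such that it and its inverse preserve inclusions. Let $\mathcal C$ be a consistent category. For a consistent cone $\gamma$ and an epimorphism $f$ with domain $c_\gamma$ let $\gamma\ast f$ be the cone $a\mapsto\gamma(a)f$. Consistent cones form a semigroup under $\gamma\cdot\delta=\gamma\ast(\delta(c_\gamma))^\circ$, and $\widehat{\mathcal C}$ is its subsemigroup of all $\epsilon\ast u$ with $\epsilon$ an idempotent cone and $u$ a bimorphism. For a semigroup $S$ let $\mathbb R(S)$ be the category with subobjects whose objects are the right ideals $eS$, $e\in E(S)$ an idempotent,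 whose morphisms $eS\to fS$ are the maps $\lambda(e,u,f)\colon x\mapsto ux$ with $u\in fSe$, and whose inclusions are the set inclusions. For $\epsilon\in E(\widehat{\mathcal C})$ let $H(\epsilon;-)\colon\mathcal C\to\mathbf{Set}$ be the functor $H(\epsilon;c)=\{\epsilon\ast f^\circ: f\in\mathcal C(c_\epsilon,c)\}$, $H(\epsilon;g)\colon\epsilon\ast f^\circ\mapsto\epsilon\ast(fg)^\circ$, and let $\eta_\epsilon\colon H(\epsilon;-)\to\mathcal C(c_\epsilon,-)$ be the natural isomorphism $\epsilon\ast f^\circ\mapsto f$. The \emph{consistent dual} $\mathcal C^*$ is the full subcategory of $[\mathcal C,\mathbf{Set}]$ on the functors $H(\epsilon;-)$, $\epsilon\in E(\widehat{\mathcal C})$, with the inclusions of subfunctors as its inclusions. \textbf{Theorem.} Let $\mathcal C$ be a consistent category. Then $\mathbb R(\widehat{\mathcal C})$ is a consistent category. There is a unique functor $G\colon\mathbb R(\widehat{\mathcal C})\to\mathcal C^*$ such that $G(\epsilon\widehat{\mathcal C})=H(\epsilon;-)$ for every $\epsilon\in E(\widehat{\mathcal C})$ and, for every morphism $\lambda=\lambda(\epsilon,\gamma,\epsilon')\colon\epsilon\widehat{\mathcal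 C}\to\epsilon'\widehat{\mathcal C}$ with $\gamma\in\epsilon'\widehat{\mathcal C}\epsilon$, $$G(\lambda)\,\eta_{\epsilon'}=\eta_\epsilon\,\mathcal C(\widetilde\gamma,-),\qquad \widetilde\gamma=\gamma(c_{\epsilon'})\,j_{c_\gamma}^{c_\epsilon}\colon c_{\epsilon'}\to c_\epsilon .$$ This functor $G$ is an isomorphism of consistent categories. Consequently $\mathcal C^*$ is a consistent category. -/

import Mathlib

open CategoryTheory

universe v u

noncomputable section

/-! ### Categories with subobjects -/

/-- A category with subobjects: a category `C` with a strict preorder subcategory on all of its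
objects. The strict preorder is given by the partial order `Sub a b` ("`a ⊆ b`") on the objects,
and `incl h : a ⟶ b` is its unique morphism `a ⟶ b` for `h : a ⊆ b` (the *inclusions*). Inclusions
are monomorphisms, and if `f ≫ j'` and `j'` are inclusions then so is `f`. -/
class CategoryWithSubobjects (C : Type u) [Category.{v} C] where
  Sub : C → C → Prop
  sub_refl : ∀ a, Sub a a
  sub_trans : ∀ {a b c}, Sub a b → Sub b c → Sub a c
  sub_antisymm : ∀ {a b}, Sub a b → Sub b a → a = b
  incl : ∀ {a b}, Sub a b → (a ⟶ b)
  incl_refl : ∀ a, incl (sub_refl a) = 𝟙 a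
  incl_trans : ∀ {a b c} (h : Sub a b) (k : Sub b c), incl h ≫ incl k = incl (sub_trans h k)
  incl_mono : ∀ {a b} (h : Sub a b), Mono (incl h)
  incl_of_comp : ∀ {a b c} (h : Sub a c) (k : Sub b c) (f : a ⟶ b),
    f ≫ incl k = incl h → ∃ l : Sub a b, f = incl l

infix:50 " ⊑ " => CategoryWithSubobjects.Sub

namespace CategoryWithSubobjects

section Basic

variable {C : Type u} [Category.{v} C] [CategoryWithSubobjects C]

instance {a b : C} (h : a ⊑ b) : Mono (incl h) := incl_mono h

/-- A retraction is a right inverse of an inclusion (in diagrammatic order). -/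
def IsRetraction {a m : C} (q : a ⟶ m) : Prop := ∃ h : m ⊑ a, incl h ≫ q = 𝟙 m

theorem IsRetraction.epi {a m : C} {q : a ⟶ m} (hq : IsRetraction q) : Epi q := by
  obtain ⟨h, hh⟩ := hq
  refine ⟨fun f g e => ?_⟩
  have := congrArg (fun t => incl h ≫ t) e
  simpa [← Category.assoc, hh] using this

/-- A bimorphism is a morphism that is both mono and epi. -/
def IsBimorphism {a b : C} (w : a ⟶ b) : Prop := Mono w ∧ Epi w

/-- `f = q w j` with `q` a retraction, `w` a bimorphism and `j` an inclusion. -/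
def HasConsistentFactorization {a b : C} (f : a ⟶ b) : Prop :=
  ∃ (n : C) (e : a ⟶ n) (h : n ⊑ b),
    (∃ (m : C) (q : a ⟶ m) (w : m ⟶ n), IsRetraction q ∧ IsBimorphism w ∧ e = q ≫ w) ∧
      f = e ≫ incl h

/-- `f = q w j` with `q` a retraction, `w` an isomorphism and `j` an inclusion. -/
def HasNormalFactorization {a b : C} (f : a ⟶ b) : Prop :=
  ∃ (n : C) (e : a ⟶ n) (h : n ⊑ b),
    (∃ (m : C) (q : a ⟶ m) (w : m ⟶ n), IsRetraction q ∧ IsIso w ∧ e = q ≫ w) ∧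
      f = e ≫ incl h

variable (C) in
/-- Every inclusion splits, and every morphism has a consistent
factorisation. -/
class HasConsistentFactorizations : Prop where
  incl_splits : ∀ {a b : C} (h : a ⊑ b), ∃ q : b ⟶ a, incl h ≫ q = 𝟙 a
  factorization : ∀ {a b : C} (f : a ⟶ b), HasConsistentFactorization f

section Image

variable [HasConsistentFactorizations C]

/-- The image of `f`: the codomain of `q w`, for a consistent factorisation `f = q w j`. It does
not depend on the factorisation, see `im_eq` and `epiPart_heq`. -/
def im {a b : C} (f : a ⟶ b) : C :=
  (HasConsistentFactorizations.factorization f).choose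

/-- The epimorphic component `f° = q w : a ⟶ im f`, for a consistent factorisation `f = q w j`. -/
def epiPart {a b : C} (f : a ⟶ b) : a ⟶ im f :=
  (HasConsistentFactorizations.factorization f).choose_spec.choose

theorem im_sub {a b : C} (f : a ⟶ b) : im f ⊑ b :=
  (HasConsistentFactorizations.factorization f).choose_spec.choose_spec.choose

theorem epiPart_spec {a b : C} (f : a ⟶ b) :
    ∃ (m : C) (q : a ⟶ m) (w : m ⟶ im f), IsRetraction q ∧ IsBimorphism w ∧ epiPart f = q ≫ w :=
  (HasConsistentFactorizations.factorization f).choose_spec.choose_spec.choose_spec.1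

@[simp] theorem epiPart_incl {a b : C} (f : a ⟶ b) : epiPart f ≫ incl (im_sub f) = f :=
  (HasConsistentFactorizations.factorization f).choose_spec.choose_spec.choose_spec.2.symm

instance epiPart_epi {a b : C} (f : a ⟶ b) : Epi (epiPart f) := by
  obtain ⟨m, q, w, hq, hw, e⟩ := epiPart_spec f
  have := hq.epi
  have := hw.2
  rw [e]
  exact epi_comp q w

theorem sub_of_epi_incl {a b m n : C} (e : a ⟶ m) [Epi e] (e' : a ⟶ n) (h : m ⊑ b) (h' : n ⊑ b)
    (eq : e ≫ incl h = e' ≫ incl h') : m ⊑ n := by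
  obtain ⟨r, hr⟩ := HasConsistentFactorizations.incl_splits h'
  have h1 : (incl h ≫ r) ≫ incl h' = incl h := by
    rw [← cancel_epi e, ← Category.assoc, ← Category.assoc, eq, Category.assoc e', hr,
      Category.comp_id]
  exact (incl_of_comp h h' _ h1).choose

/-- Factorisations into an epimorphism and an inclusion are unique. -/
theorem epi_incl_unique {a b m n : C} (e : a ⟶ m) [Epi e] (e' : a ⟶ n) [Epi e'] (h : m ⊑ b)
    (h' : n ⊑ b) (eq : e ≫ incl h = e' ≫ incl h') : m = n ∧ HEq e e' := by
  obtain rfl : m = n := sub_antisymm (sub_of_epi_incl e e' h h' eq)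
    (sub_of_epi_incl e' e h' h eq.symm)
  exact ⟨rfl, heq_of_eq ((cancel_mono (incl h)).1 eq)⟩

theorem im_eq {a b m : C} (f : a ⟶ b) (e : a ⟶ m) [Epi e] (h : m ⊑ b) (eq : f = e ≫ incl h) :
    im f = m :=
  (epi_incl_unique (epiPart f) e (im_sub f) h (by rw [epiPart_incl, eq])).1

theorem epiPart_heq {a b m : C} (f : a ⟶ b) (e : a ⟶ m) [Epi e] (h : m ⊑ b)
    (eq : f = e ≫ incl h) : HEq (epiPart f) e :=
  (epi_incl_unique (epiPart f) e (im_sub f) h (by rw [epiPart_incl, eq])).2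

end Image

/-! ### Consistent bimorphisms -/

/-- The morphisms of the subcategory of `C` generated by the inclusions and the retractions among
the subobjects of `c`. -/
inductive InCore (c : C) : ∀ {x y : C}, (x ⟶ y) → Prop
  | incl {x y : C} (h : x ⊑ y) (hy : y ⊑ c) : InCore c (incl h)
  | retraction {x y : C} (q : y ⟶ x) (hq : IsRetraction q) (hy : y ⊑ c) : InCore c q
  | comp {x y z : C} (f : x ⟶ y) (g : y ⟶ z) : InCore c f → InCore c g → InCore c (f ≫ g)

/-- The objects of `⟨c⟩`: the subobjects of `c`. -/
structure Core (c : C) where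
  obj : C
  sub : obj ⊑ c

/-- The category `⟨c⟩` generated by the inclusions and the retractions among the subobjects
of `c`. -/
instance (c : C) : Category (Core c) where
  Hom x y := {f : x.obj ⟶ y.obj // InCore c f}
  id x := ⟨𝟙 x.obj, by rw [← incl_refl]; exact InCore.incl _ x.sub⟩
  comp f g := ⟨f.1 ≫ g.1, InCore.comp _ _ f.2 g.2⟩
  id_comp f := Subtype.ext (Category.id_comp f.1)
  comp_id f := Subtype.ext (Category.comp_id f.1)
  assoc f g h := Subtype.ext (Category.assoc f.1 g.1 h.1)

/-- The inclusion functor `J(⟨c⟩, C)`. -/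
def Core.J (c : C) : Core c ⥤ C where
  obj x := x.obj
  map f := f.1

/-- An inclusion among subobjects of `c`, as a morphism of `⟨c⟩`. -/
def Core.incl {c : C} {x y : Core c} (h : x.obj ⊑ y.obj) : x ⟶ y :=
  ⟨CategoryWithSubobjects.incl h, InCore.incl h y.sub⟩

end Basic

/-- An isomorphism of categories: a functor with a two-sided inverse functor. -/
def IsCategoryIso {A : Type*} {B : Type*} [Category A] [Category B] (F : A ⥤ B) : Prop :=
  ∃ K : B ⥤ A, F ⋙ K = 𝟭 A ∧ K ⋙ F = 𝟭 B

section Consistent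

variable {C : Type u} [Category.{v} C] [CategoryWithSubobjects C]

/-- `T : ⟨c⟩ ⥤ ⟨d⟩` extends the functor `T^w : σ(c) ⥤ σ(d)` on the preorders of subobjects, which
sends `c' ⊆ c` to `im (j w)`, `j` being the inclusion of `c'` in `c`, and the inclusion of `c'`
in `c''` to the inclusion of `T^w c'` in `T^w c''`. -/
def ExtendsImageFunctor [HasConsistentFactorizations C] {c d : C} (w : c ⟶ d)
    (T : Core c ⥤ Core d) : Prop :=
  (∀ x : Core c, (T.obj x).obj = im (incl x.sub ≫ w)) ∧
    ∀ (x y : Core c) (h : x.obj ⊑ y.obj), ∃ h' : (T.obj x).obj ⊑ (T.obj y).obj,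
      T.map (Core.incl h) = Core.incl h'

/-- The bimorphism `w : c ⟶ d` is consistent: `T^w` has a unique extension to an isomorphism
`T : ⟨c⟩ ⥤ ⟨d⟩` such that the epimorphic components `(j w)° : c' ⟶ T c'`, for `j` the inclusion of
`c' ⊆ c` in `c`, are natural on `⟨c⟩`. (As `T c' = im (j w)`, the equation
`τ_{c'} ≫ incl = j ≫ w` says exactly that `τ_{c'} = (j w)°`.) -/
def IsConsistentBimorphism [HasConsistentFactorizations C] {c d : C} (w : c ⟶ d) : Prop :=
  ∃! T : Core c ⥤ Core d, ExtendsImageFunctor w T ∧ IsCategoryIso T ∧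
    ∃ τ : Core.J c ⟶ T ⋙ Core.J d, ∀ x : Core c,
      (τ.app x : x.obj ⟶ (T.obj x).obj) ≫ incl (T.obj x).sub = incl x.sub ≫ w

end Consistent

/-! ### Consistent cones and consistent categories -/

/-- A consistent cone: components `γ(a) : a ⟶ c_γ` compatible with the inclusions, at least one of
which is a bimorphism. -/
structure ConsistentCone (C : Type u) [Category.{v} C] [CategoryWithSubobjects C] where
  vertex : C
  app : ∀ a : C, a ⟶ vertex
  incl_app : ∀ {a b : C} (h : a ⊑ b), incl h ≫ app b = app a
  exists_bimorphism : ∃ c : C, IsBimorphism (app c)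

/-- A consistent category: a category with subobjects in which every inclusion splits, every
morphism has a consistent factorisation, every bimorphism is consistent, every composite of an
inclusion and a retraction has a normal factorisation, and every object `c` is the vertex of a
consistent cone with component `1_c` at `c`. -/
class ConsistentCategory (C : Type u) [Category.{v} C] [CategoryWithSubobjects C] : Prop
    extends HasConsistentFactorizations C where
  bimorphism_consistent : ∀ {c d : C} (w : c ⟶ d), IsBimorphism w → IsConsistentBimorphism w
  normal_factorization : ∀ {a b m : C} (h : a ⊑ b) (q : b ⟶ m), IsRetraction q →
    HasNormalFactorization (incl h ≫ q)
  exists_cone : ∀ c : C, ∃ ε : ConsistentCone C, ∃ h : ε.vertex = c, ε.app c ≫ eqToHom h = 𝟙 c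

/-! ### The semigroup of consistent cones -/

namespace ConsistentCone

variable {C : Type u} [Category.{v} C] [CategoryWithSubobjects C]

theorem ext' {γ δ : ConsistentCone C} (h : γ.vertex = δ.vertex)
    (h' : ∀ a, HEq (γ.app a) (δ.app a)) : γ = δ := by
  cases γ with
  | mk v f _ _ =>
    cases δ with
    | mk v' f' _ _ =>
      obtain rfl : v = v' := h
      obtain rfl : f = f' := funext fun a => eq_of_heq (h' a)
      rfl

variable [HasConsistentFactorizations C]

theorem exists_bimorphism_comp (γ : ConsistentCone C) {d : C} (f : γ.vertex ⟶ d) [Epi f] :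
    ∃ c : C, IsBimorphism (γ.app c ≫ f) := by
  obtain ⟨c, -, hc⟩ := γ.exists_bimorphism
  have he : Epi (γ.app c ≫ f) := epi_comp _ _
  obtain ⟨n, e, h, ⟨m, q, w, ⟨k, hk⟩, hw, rfl⟩, hf⟩ :=
    HasConsistentFactorizations.factorization (γ.app c ≫ f)
  have hq : Epi q := IsRetraction.epi ⟨k, hk⟩
  have := hw.2
  have hqw : Epi (q ≫ w) := epi_comp _ _
  obtain ⟨rfl, -⟩ := epi_incl_unique (q ≫ w) (γ.app c ≫ f) h (sub_refl d)
    (by rw [← hf, incl_refl, Category.comp_id])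
  refine ⟨m, ?_⟩
  have : γ.app m ≫ f = w := by
    rw [← γ.incl_app k, Category.assoc, hf, show incl h = 𝟙 _ from incl_refl _, Category.comp_id,
      ← Category.assoc, hk, Category.id_comp]
  rw [this]
  exact hw

/-- The cone `γ ∗ f : a ↦ γ(a) f`, for an epimorphism `f` from the vertex of `γ`. -/
def star (γ : ConsistentCone C) {d : C} (f : γ.vertex ⟶ d) [Epi f] : ConsistentCone C where
  vertex := d
  app a := γ.app a ≫ f
  incl_app h := by rw [← Category.assoc, γ.incl_app]
  exists_bimorphism := γ.exists_bimorphism_comp f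

theorem star_congr (γ : ConsistentCone C) {b m n : C} (e : γ.vertex ⟶ m) [Epi e]
    (e' : γ.vertex ⟶ n) [Epi e'] (h : m ⊑ b) (h' : n ⊑ b)
    (eq : e ≫ incl h = e' ≫ incl h') : γ.star e = γ.star e' := by
  obtain ⟨rfl, he⟩ := epi_incl_unique e e' h h' eq
  obtain rfl := eq_of_heq he
  rfl

theorem star_star (γ : ConsistentCone C) {d d' : C} (f : γ.vertex ⟶ d) [Epi f] (g : d ⟶ d')
    [hg : Epi g] : @star C _ _ _ (γ.star f) d' g hg = γ.star (f ≫ g) :=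
  ext' rfl fun _ => heq_of_eq (Category.assoc _ _ _)

/-- The product `γ · δ = γ ∗ (δ(c_γ))°` of consistent cones. -/
instance : Mul (ConsistentCone C) := ⟨fun γ δ => γ.star (epiPart (δ.app γ.vertex))⟩

theorem mul_def (γ δ : ConsistentCone C) : γ * δ = γ.star (epiPart (δ.app γ.vertex)) := rfl

instance : Semigroup (ConsistentCone C) where
  mul_assoc α β γ := by
    have h1 : α * β * γ = α.star (epiPart (β.app α.vertex) ≫
        epiPart (γ.app (im (β.app α.vertex)))) :=
      star_star α (epiPart (β.app α.vertex)) (epiPart (γ.app (im (β.app α.vertex))))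
    have h2 : α * (β * γ) = α.star (epiPart (β.app α.vertex ≫ epiPart (γ.app β.vertex))) := rfl
    rw [h1, h2]
    refine star_congr (b := γ.vertex) α _ _ (im_sub (γ.app (im (β.app α.vertex))))
      (sub_trans (im_sub (β.app α.vertex ≫ epiPart (γ.app β.vertex)))
        (im_sub (γ.app β.vertex))) ?_
    rw [← incl_trans (im_sub (β.app α.vertex ≫ epiPart (γ.app β.vertex)))
        (im_sub (γ.app β.vertex)), Category.assoc, epiPart_incl,
      ← γ.incl_app (im_sub (β.app α.vertex)), ← Category.assoc, epiPart_incl, ← Category.assoc,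
      epiPart_incl, Category.assoc, epiPart_incl]

end ConsistentCone

namespace ConsistentCone

section Idempotent

variable {C : Type u} [Category.{v} C] [CategoryWithSubobjects C] [HasConsistentFactorizations C]

/-- The vertex component of an idempotent cone is the identity. -/
theorem app_vertex_of_idem {ε : ConsistentCone C} (hε : IsIdempotentElem ε) :
    ε.app ε.vertex = 𝟙 ε.vertex := by
  have key : ∀ δ : ConsistentCone C, (hv : δ.vertex ⊑ ε.vertex) →
      (∀ a, δ.app a ≫ incl hv = ε.app a ≫ ε.app ε.vertex) → δ = ε →
      ε.app ε.vertex = 𝟙 ε.vertex := by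
    rintro δ hv h rfl
    obtain ⟨c, -, hc⟩ := δ.exists_bimorphism
    rw [← cancel_epi (δ.app c), ← h c, show incl hv = 𝟙 _ from incl_refl _]
  have h : ∀ a, (ε.app a ≫ epiPart (ε.app ε.vertex)) ≫ incl (im_sub (ε.app ε.vertex)) =
      ε.app a ≫ ε.app ε.vertex := fun a => by rw [Category.assoc, epiPart_incl]
  exact key (ε * ε) (im_sub _) h hε

/-- A cone whose vertex component is the identity is idempotent. -/
theorem idem_of_app_vertex {ε : ConsistentCone C} (h : ε.app ε.vertex = 𝟙 ε.vertex) :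
    IsIdempotentElem ε := by
  have h1 : ε * ε = ε.star (𝟙 ε.vertex) :=
    star_congr (b := ε.vertex) ε _ _ (im_sub _) (sub_refl _) (by
      rw [epiPart_incl, h, incl_refl, Category.comp_id])
  exact h1.trans (ext' rfl fun a => heq_of_eq (Category.comp_id _))

end Idempotent

end ConsistentCone

open ConsistentCone

section Hat

variable (C : Type u) [Category.{v} C] [CategoryWithSubobjects C] [HasConsistentFactorizations C]

/-- The semigroup `Ĉ` of all the consistent cones of the form `ε ∗ w`, with `ε` an idempotent
cone and `w` a bimorphism. -/
def Hat : Subsemigroup (ConsistentCone C) where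
  carrier := {γ | ∃ ε : ConsistentCone C, IsIdempotentElem ε ∧
    ∃ (d : C) (w : ε.vertex ⟶ d) (hw : IsBimorphism w), γ = @star C _ _ _ ε d w hw.2}
  mul_mem' := by
    rintro _ δ ⟨ε, hε, d, w, hw, rfl⟩ -
    have := hw.2
    obtain ⟨n, e, h, ⟨m, q, b, ⟨k, hk⟩, hb, rfl⟩, hf⟩ :=
      HasConsistentFactorizations.factorization (w ≫ epiPart (δ.app d))
    have hq : Epi q := IsRetraction.epi ⟨k, hk⟩
    have := hb.2
    have h1 : ε.star w * δ = ε.star (w ≫ epiPart (δ.app d)) :=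
      star_star ε w (epiPart (δ.app d))
    refine ⟨ε.star q, idem_of_app_vertex ?_, n, b, hb, ?_⟩
    · change ε.app m ≫ q = 𝟙 m
      rw [← ε.incl_app k, app_vertex_of_idem hε, Category.comp_id, hk]
    · rw [h1, star_star ε q b]
      refine star_congr ε _ _ (sub_refl _) h ?_
      rw [← hf, incl_refl, Category.comp_id]

end Hat

/-! ### Principal right ideals of a semigroup -/

section RightIdeals

variable (S : Type u) [Semigroup S]

/-- The objects of `ℝ(S)`: the principal right ideals `eS` generated by idempotents. -/
structure RightIdeals where
  carrier : Set S
  exists_idem : ∃ e : S, IsIdempotentElem e ∧ carrier = Set.range (fun s => e * s)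

variable {S}

/-- The object `eS` of `ℝ(S)`. -/
def RightIdeals.of (e : S) (he : IsIdempotentElem e) : RightIdeals S :=
  ⟨Set.range (fun s => e * s), e, he, rfl⟩

/-- The maps of the form `λ(e, s, f) : eS → fS, x ↦ s x`, with `s ∈ fSe`. -/
def IsLambda {A B : RightIdeals S} (φ : A.carrier → B.carrier) : Prop :=
  ∃ e f s : S, IsIdempotentElem e ∧ IsIdempotentElem f ∧
    A.carrier = Set.range (fun t => e * t) ∧ B.carrier = Set.range (fun t => f * t) ∧
    (∃ t, s = f * t * e) ∧ ∀ x, (φ x : S) = s * x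

theorem isLambda_incl {A B : RightIdeals S} (h : A.carrier ⊆ B.carrier) :
    IsLambda (A := A) (B := B) (Set.inclusion h) := by
  obtain ⟨e, he, hA⟩ := A.exists_idem
  obtain ⟨f, hf, hB⟩ := B.exists_idem
  have hee : ∀ x ∈ A.carrier, e * x = x := by
    rintro x hx
    rw [hA] at hx
    obtain ⟨t, rfl⟩ := hx
    change e * (e * t) = e * t
    rw [← mul_assoc, he.eq]
  have heB : e ∈ B.carrier := h (by rw [hA]; exact ⟨e, he.eq⟩)
  rw [hB] at heB
  obtain ⟨t, ht⟩ := heB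
  have ht' : f * t = e := ht
  refine ⟨e, f, e, he, hf, hA, hB, ⟨t, ?_⟩, fun x => ?_⟩
  · rw [ht', he.eq]
  · exact (hee x.1 x.2).symm

theorem isLambda_comp {A B D : RightIdeals S} {φ : A.carrier → B.carrier}
    {ψ : B.carrier → D.carrier} (hφ : IsLambda φ) (hψ : IsLambda ψ) : IsLambda (ψ ∘ φ) := by
  obtain ⟨e, f, s, he, hf, hA, hB, ⟨t, rfl⟩, h⟩ := hφ
  obtain ⟨f', g, s', hf', hg, hB', hD, ⟨t', rfl⟩, h'⟩ := hψ
  refine ⟨e, g, (g * t' * f') * (f * t * e), he, hg, hA, hD,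
    ⟨t' * f' * (f * t), by simp only [mul_assoc]⟩, fun x => ?_⟩
  rw [Function.comp_apply, h', h, mul_assoc (g * t' * f')]

/-- The category `ℝ(S)`. -/
instance : Category (RightIdeals S) where
  Hom A B := {φ : A.carrier → B.carrier // IsLambda φ}
  id A := ⟨id, isLambda_incl (A := A) (B := A) subset_rfl⟩
  comp φ ψ := ⟨ψ.1 ∘ φ.1, isLambda_comp φ.2 ψ.2⟩

/-- The morphism `λ(e, s, f) : eS ⟶ fS` of `ℝ(S)`, for `s ∈ fSe`. -/
def RightIdeals.lam {e f : S} (he : IsIdempotentElem e) (hf : IsIdempotentElem f) (s : S)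
    (hs : ∃ t, s = f * t * e) : RightIdeals.of e he ⟶ RightIdeals.of f hf :=
  ⟨fun x => ⟨s * x, by
    obtain ⟨t, rfl⟩ := hs
    exact ⟨t * e * x, by simp only [mul_assoc]⟩⟩, e, f, s, he, hf, rfl, rfl, hs, fun _ => rfl⟩

/-- The inclusions of `ℝ(S)` are the set inclusions between principal right ideals. -/
instance : CategoryWithSubobjects (RightIdeals S) where
  Sub A B := A.carrier ⊆ B.carrier
  sub_refl _ := subset_rfl
  sub_trans h k := h.trans k
  sub_antisymm {A B} h k := by
    cases A
    cases B
    obtain rfl := Set.Subset.antisymm h k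
    rfl
  incl h := ⟨Set.inclusion h, isLambda_incl h⟩
  incl_refl _ := rfl
  incl_trans _ _ := rfl
  incl_mono h := ⟨fun φ ψ e => Subtype.ext (funext fun x =>
    Set.inclusion_injective h (congrFun (congrArg Subtype.val e) x))⟩
  incl_of_comp {A B D} h k φ e := by
    have hx : ∀ x, (φ.1 x : S) = x := fun x =>
      congrArg Subtype.val (congrFun (congrArg Subtype.val e) x)
    have hAB : A.carrier ⊆ B.carrier := fun x hxA => by
      have := (φ.1 ⟨x, hxA⟩).2
      rwa [hx] at this
    exact ⟨hAB, Subtype.ext (funext fun x => Subtype.ext (hx x))⟩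

end RightIdeals

/-! ### Set-valued functors and the consistent dual -/

/-- A functor from `C` to the category of sets whose values are sets of elements of `U`. (Here sets
are subsets of a type, rather than types, so that equality and inclusion of the values have their
set-theoretic meaning.) -/
structure SetFunctor (C : Type u) [Category.{v} C] (U : Type u) where
  obj : C → Set U
  map : ∀ {c d : C}, (c ⟶ d) → obj c → obj d
  map_id : ∀ (c : C) (x : obj c), map (𝟙 c) x = x
  map_comp : ∀ {c d e : C} (f : c ⟶ d) (g : d ⟶ e) (x : obj c), map (f ≫ g) x = map g (map f x)

/-- The underlying functor `C ⥤ Type u`. -/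
def SetFunctor.toFunctor {C : Type u} [Category.{v} C] {U : Type u} (F : SetFunctor C U) :
    C ⥤ Type u where
  obj c := F.obj c
  map f := TypeCat.ofHom (F.map f)
  map_id c := by ext x; exact congrArg Subtype.val (F.map_id c x)
  map_comp f g := by ext x; exact congrArg Subtype.val (F.map_comp f g x)

/-- `F ⊆ G`: every `F(c)` is a subset of `G(c)` and the inclusion maps are
natural. -/
def IsSubfunctor {C : Type u} [Category.{v} C] {U : Type u} (F G : SetFunctor C U) : Prop :=
  ∃ h : ∀ c, F.obj c ⊆ G.obj c, ∀ {c d : C} (f : c ⟶ d) (x : F.obj c),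
    G.map f (Set.inclusion (h c) x) = Set.inclusion (h d) (F.map f x)

/-- The inclusion of a subfunctor, as a natural transformation. -/
def IsSubfunctor.incl {C : Type u} [Category.{v} C] {U : Type u}
    {F G : SetFunctor C U} (h : IsSubfunctor F G) :
    F.toFunctor ⟶ G.toFunctor where
  app c := TypeCat.ofHom (Set.inclusion (h.choose c))
  naturality c d f := by
    ext x
    exact (h.choose_spec f x).symm

theorem IsSubfunctor.antisymm {C : Type u} [Category.{v} C] {U : Type u}
    {F G : SetFunctor C U} (h : IsSubfunctor F G)
    (k : IsSubfunctor G F) : F = G := by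
  cases F with
  | mk Fo Fm _ _ =>
    cases G with
    | mk Go Gm _ _ =>
      obtain ⟨h, h'⟩ := h
      obtain ⟨k, -⟩ := k
      obtain rfl : Fo = Go := funext fun c => Set.Subset.antisymm (h c) (k c)
      have : @Fm = @Gm := by
        funext c d f x
        exact (h' f x).symm
      subst this
      rfl

section Dual

variable {C : Type u} [SmallCategory C] [CategoryWithSubobjects C] [HasConsistentFactorizations C]

/-- The value `H(ε; c) = {ε ∗ f° : f ∈ C(c_ε, c)}`. -/
def HSet (ε : ConsistentCone C) (c : C) : Set (ConsistentCone C) :=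
  {γ | ∃ f : ε.vertex ⟶ c, γ = ε.star (epiPart f)}

theorem star_epiPart_injective {ε : ConsistentCone C} (hε : IsIdempotentElem ε) {c : C}
    {f g : ε.vertex ⟶ c} (h : ε.star (epiPart f) = ε.star (epiPart g)) : f = g := by
  have aux : ∀ (δ δ' : ConsistentCone C), δ = δ' → ∀ (hv : δ.vertex ⊑ c) (hv' : δ'.vertex ⊑ c),
      δ.app ε.vertex ≫ incl hv = δ'.app ε.vertex ≫ incl hv' := by
    rintro δ _ rfl _ _
    rfl
  have key : ∀ f : ε.vertex ⟶ c,
      (ε.app ε.vertex ≫ epiPart f) ≫ incl (im_sub f) = f := fun f => by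
    rw [app_vertex_of_idem hε, Category.id_comp, epiPart_incl]
  exact (key f).symm.trans ((aux _ _ h (im_sub f) (im_sub g)).trans (key g))

/-- The element `ε ∗ f°` of `H(ε; c)`. -/
def HSet.mk (ε : ConsistentCone C) {c : C} (f : ε.vertex ⟶ c) : HSet ε c :=
  ⟨ε.star (epiPart f), f, rfl⟩

/-- The morphism `f` for which a given element of `H(ε; c)` is `ε ∗ f°`. It is unique when `ε` is
idempotent, see `HSet.hom_mk`. -/
def HSet.hom {ε : ConsistentCone C} {c : C} (x : HSet ε c) : ε.vertex ⟶ c := x.2.choose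

theorem HSet.mk_hom {ε : ConsistentCone C} {c : C} (x : HSet ε c) : HSet.mk ε (HSet.hom x) = x :=
  Subtype.ext x.2.choose_spec.symm

theorem HSet.hom_mk {ε : ConsistentCone C} (hε : IsIdempotentElem ε) {c : C} (f : ε.vertex ⟶ c) :
    HSet.hom (HSet.mk ε f) = f :=
  star_epiPart_injective hε (HSet.mk ε f).2.choose_spec.symm

/-- The `H`-functor `H(ε; -)` of an idempotent cone, with `H(ε; g) : ε ∗ f° ↦ ε ∗ (f g)°`. -/
def H (ε : ConsistentCone C) (hε : IsIdempotentElem ε) : SetFunctor C (ConsistentCone C) where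
  obj := HSet ε
  map g x := HSet.mk ε (HSet.hom x ≫ g)
  map_id c x := by rw [Category.comp_id, HSet.mk_hom]
  map_comp f g x := by rw [HSet.hom_mk hε, Category.assoc]

theorem H_map (ε : ConsistentCone C) (hε : IsIdempotentElem ε) {c d : C} (f : ε.vertex ⟶ c)
    (g : c ⟶ d) : (H ε hε).map g (HSet.mk ε f) = HSet.mk ε (f ≫ g) := by
  change HSet.mk ε (HSet.hom (HSet.mk ε f) ≫ g) = _
  rw [HSet.hom_mk hε]

/-- The natural isomorphism `η_ε : H(ε; -) ⟶ C(c_ε, -)`, `ε ∗ f° ↦ f`. -/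
def eta (ε : ConsistentCone C) (hε : IsIdempotentElem ε) :
    (H ε hε).toFunctor ≅ coyoneda.obj (Opposite.op ε.vertex) :=
  NatIso.ofComponents
    (fun c => Equiv.toIso
      { toFun := HSet.hom
        invFun := fun f => HSet.mk ε f
        left_inv := HSet.mk_hom
        right_inv := HSet.hom_mk hε })
    (fun {c d} g => by
      ext x
      exact HSet.hom_mk hε _)

variable (C) in
/-- The objects of the consistent dual `C*`: the functors `H(ε; -)`, for `ε ∈ E(Ĉ)`. -/
structure ConsistentDual where
  functor : SetFunctor C (ConsistentCone C)
  exists_idem : ∃ (ε : ConsistentCone C) (hε : IsIdempotentElem ε), ε ∈ Hat C ∧ functor = H ε hε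

/-- `C*` is a full subcategory of the category of functors from `C` to sets. -/
instance : Category (ConsistentDual C) where
  Hom F G := F.functor.toFunctor ⟶ G.functor.toFunctor
  id F := 𝟙 F.functor.toFunctor
  comp φ ψ := NatTrans.vcomp φ ψ

variable (C) in
/-- The inclusion functor of `C*` into the category of functors from `C` to sets. -/
def ConsistentDual.toFunctor : ConsistentDual C ⥤ (C ⥤ Type u) where
  obj F := F.functor.toFunctor
  map φ := φ

/-- The inclusions of `C*` are the inclusions of subfunctors. -/
instance : CategoryWithSubobjects (ConsistentDual C) where
  Sub F G := IsSubfunctor F.functor G.functor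
  sub_refl F := ⟨fun _ => subset_rfl, fun _ _ => rfl⟩
  sub_trans h k := ⟨fun c => (h.choose c).trans (k.choose c), fun f x =>
    (k.choose_spec f _).trans (congrArg (Set.inclusion (k.choose _)) (h.choose_spec f x))⟩
  sub_antisymm {F G} h k := by
    cases F
    cases G
    obtain rfl := h.antisymm k
    rfl
  incl h := h.incl
  incl_refl _ := rfl
  incl_trans _ _ := rfl
  incl_mono {F G} h := ⟨fun {K} φ ψ e => by
    have e' : ∀ c x, h.incl.app c (NatTrans.app φ c x) = h.incl.app c (NatTrans.app ψ c x) :=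
      fun c x => congrArg (fun t : NatTrans K.functor.toFunctor G.functor.toFunctor => t.app c x) e
    refine NatTrans.ext (funext fun c => ?_)
    ext x
    exact Set.inclusion_injective (h.choose c) (e' c x)⟩
  incl_of_comp {F G K} h k φ e := by
    let φ' : ∀ c, F.functor.obj c → G.functor.obj c := fun c => NatTrans.app φ c
    have hx : ∀ c (x : F.functor.obj c), (φ' c x : ConsistentCone C) = x := fun c x => by
      have h1 : k.incl.app c (φ' c x) = h.incl.app c x :=
        congrArg (fun t : NatTrans F.functor.toFunctor K.functor.toFunctor => t.app c x) e
      exact congrArg (fun y : K.functor.obj c => (y : ConsistentCone C)) h1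
    have hFG : ∀ c, F.functor.obj c ⊆ G.functor.obj c := fun c x hxF => by
      have := (φ' c ⟨x, hxF⟩).2
      rwa [hx c ⟨x, hxF⟩] at this
    have hnat : ∀ c (x : F.functor.obj c), φ' c x = Set.inclusion (hFG c) x :=
      fun c x => Subtype.ext (hx c x)
    refine ⟨⟨hFG, fun {c d} f x => ?_⟩, ?_⟩
    · rw [← hnat, ← hnat]
      exact (ConcreteCategory.congr_hom (NatTrans.naturality φ f) x).symm
    · refine NatTrans.ext (funext fun c => ?_)
      ext x
      exact hnat c x

/-! ### The functor `G : ℝ(Ĉ) ⥤ C*` -/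

theorem coe_idem {ε : Hat C} (hε : IsIdempotentElem ε) :
    IsIdempotentElem (ε : ConsistentCone C) := congrArg Subtype.val hε

/-- The object `H(ε; -)` of `C*`, for an idempotent `ε` of `Ĉ`. -/
def ConsistentDual.of (ε : Hat C) (hε : IsIdempotentElem ε) : ConsistentDual C :=
  ⟨H ε (coe_idem hε), ε, coe_idem hε, ε.2, rfl⟩

theorem vertex_sub {ε ε' γ : Hat C} (hγ : ∃ t, γ = ε' * t * ε) :
    (γ : ConsistentCone C).vertex ⊑ (ε : ConsistentCone C).vertex := by
  obtain ⟨t, rfl⟩ := hγ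
  exact im_sub _

/-- The morphism `γ̃ = γ(c_{ε'}) j : c_{ε'} ⟶ c_ε`, for `γ ∈ ε'Ĉε` and `j` the inclusion of `c_γ`
in `c_ε`. -/
def tilde {ε ε' γ : Hat C} (hγ : ∃ t, γ = ε' * t * ε) :
    (ε' : ConsistentCone C).vertex ⟶ (ε : ConsistentCone C).vertex :=
  (γ : ConsistentCone C).app _ ≫ incl (vertex_sub hγ)

/-- `G : ℝ(Ĉ) ⥤ C*` is the functor with `G(εĈ) = H(ε; -)` which sends `λ = λ(ε, γ, ε')` to the
natural transformation with `G(λ) η_{ε'} = η_ε C(γ̃, -)`. -/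
structure IsDualFunctor (G : RightIdeals (Hat C) ⥤ ConsistentDual C) : Prop where
  obj_of : ∀ (ε : Hat C) (hε : IsIdempotentElem ε),
    G.obj (RightIdeals.of ε hε) = ConsistentDual.of ε hε
  map_lam : ∀ {ε ε' : Hat C} (hε : IsIdempotentElem ε) (hε' : IsIdempotentElem ε') (γ : Hat C)
    (hγ : ∃ t, γ = ε' * t * ε),
    (ConsistentDual.toFunctor C).map (eqToHom (obj_of ε hε).symm ≫
        G.map (RightIdeals.lam hε hε' γ hγ) ≫ eqToHom (obj_of ε' hε')) ≫
          (eta (ε' : ConsistentCone C) (coe_idem hε')).hom =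
      (eta (ε : ConsistentCone C) (coe_idem hε)).hom ≫ coyoneda.map (tilde hγ).op

end Dual

/-! ### Isomorphisms of categories with subobjects -/

/-- `F` preserves inclusions. -/
def PreservesInclusions {A : Type*} {B : Type*} [Category A] [Category B]
    [CategoryWithSubobjects A] [CategoryWithSubobjects B] (F : A ⥤ B) : Prop :=
  ∀ {a b : A} (h : a ⊑ b), ∃ k : F.obj a ⊑ F.obj b, F.map (incl h) = incl k

/-- An isomorphism of consistent categories: an isomorphism of categories that preserves
inclusions, and so does its inverse. -/
def IsConsistentIso {A : Type*} {B : Type*} [Category A] [Category B]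
    [CategoryWithSubobjects A] [CategoryWithSubobjects B] (F : A ⥤ B) : Prop :=
  PreservesInclusions F ∧
    ∃ K : B ⥤ A, F ⋙ K = 𝟭 A ∧ K ⋙ F = 𝟭 B ∧ PreservesInclusions K

end CategoryWithSubobjects

end

open CategoryWithSubobjects

/-! The axioms of a consistent category split into two layers. One layer, `SplitConsistent`,
mentions only split epimorphisms, split monomorphisms and bimorphisms; it is self-dual and invariant
under equivalence. The other concerns inclusions: they split, every split monomorphism is an
isomorphism followed by an inclusion, and every object carries a cone that is the identity there.
Consistency implies the first layer (`splitConsistent`), and both layers together imply consistency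
(`SplitConsistent.consistentCategory`). The hard clause in both directions is the consistency of
bimorphisms, which amounts to transporting splittings of subobjects along `w`.

By Yoneda and `eta`, `H(ε; -)` corresponds to `c_ε`, so `C*` is equivalent to `Cᵒᵖ` and inherits the
first layer from `C`. The second layer holds in `ℝ(S)` for every semigroup `S`, by computing with
idempotents.

The link is that `H(ε; c)` is the set of elements of `εĈ` with vertex below `c` (`mem_HSet`). It
therefore depends only on the ideal, and a morphism `x ↦ γx` of ideals restricts to a natural
transformation. This is `dualFunctor`; it is bijective on objects, matches the inclusions, and is
fully faithful by a Yoneda argument on the element `ε`. Thus `ℝ(Ĉ)` obtains the first layer from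
`C*`, and `C*` obtains the second from `ℝ(Ĉ)`. -/

namespace CategoryWithSubobjects

/-! ### Isomorphisms of categories. -/

section Functors

/-- The strict inverse acts on morphisms by conjugating with `eqToHom` and taking preimages under
`F`. -/
theorem isCategoryIso_of_bijective {A B : Type*} [Category A] [Category B] (F : A ⥤ B) [F.Full]
    [F.Faithful] (hF : Function.Bijective F.obj) : IsCategoryIso F := by
  let e := Equiv.ofBijective F.obj hF
  have hK : ∀ b, F.obj (e.symm b) = b := e.apply_symm_apply
  have hK' : ∀ a, e.symm (F.obj a) = a := e.symm_apply_apply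
  let K : B ⥤ A :=
    { obj := e.symm
      map := fun {x y} f => F.preimage (eqToHom (hK x) ≫ f ≫ eqToHom (hK y).symm)
      map_id := fun x => F.map_injective (by simp)
      map_comp := fun f g => F.map_injective (by simp) }
  refine ⟨K, CategoryTheory.Functor.ext hK' fun x y f => F.map_injective ?_,
    CategoryTheory.Functor.ext hK fun x y f => ?_⟩
  · simp [K, eqToHom_map]
  · simp [K]

theorem IsCategoryIso.isEquivalence {A B : Type*} [Category A] [Category B] {F : A ⥤ B}
    (hF : IsCategoryIso F) : F.IsEquivalence := by
  obtain ⟨K, h, k⟩ := hF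
  exact (CategoryTheory.Equivalence.mk F K (eqToIso h.symm) (eqToIso k)).isEquivalence_functor

theorem IsCategoryIso.bijective_obj {A B : Type*} [Category A] [Category B] {F : A ⥤ B}
    (hF : IsCategoryIso F) : Function.Bijective F.obj := by
  obtain ⟨K, h, k⟩ := hF
  exact Function.bijective_iff_has_inverse.2
    ⟨K.obj, fun a => Functor.congr_obj h a, fun b => Functor.congr_obj k b⟩

end Functors

/-! ### Split quotients and bimorphisms -/

/-- The self-dual part of the axioms of a consistent category, which does not mention inclusions:
every morphism is a split epimorphism followed by a bimorphism and a split monomorphism, a split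
monomorphism followed by a split epimorphism is a split epimorphism followed by a split
monomorphism, and split quotients can be moved along bimorphisms in both directions. -/
structure SplitConsistent (C : Type*) [Category C] : Prop where
  factorization : ∀ {a b : C} (f : a ⟶ b), ∃ (m n : C) (p : a ⟶ m) (w : m ⟶ n) (i : n ⟶ b),
    IsSplitEpi p ∧ Mono w ∧ Epi w ∧ IsSplitMono i ∧ p ≫ w ≫ i = f
  exchange : ∀ {a b c : C} (i : a ⟶ b) (p : b ⟶ c), IsSplitMono i → IsSplitEpi p →
    ∃ (m : C) (p' : a ⟶ m) (i' : m ⟶ c), IsSplitEpi p' ∧ IsSplitMono i' ∧ p' ≫ i' = i ≫ p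
  lift : ∀ {c d k : C} (w : c ⟶ d), Mono w → Epi w → ∀ (e : d ⟶ k) (s : k ⟶ d), s ≫ e = 𝟙 k →
    ∃ (m : C) (e' : c ⟶ m) (s' : m ⟶ c) (t : m ⟶ k),
      s' ≫ e' = 𝟙 m ∧ e' ≫ t = w ≫ e ∧ s' ≫ w = t ≫ s
  descend : ∀ {c d m : C} (w : c ⟶ d), Mono w → Epi w → ∀ (e' : c ⟶ m) (s' : m ⟶ c),
    s' ≫ e' = 𝟙 m → ∃ (k : C) (e : d ⟶ k) (s : k ⟶ d) (t : m ⟶ k),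
      s ≫ e = 𝟙 k ∧ e' ≫ t = w ≫ e ∧ s' ≫ w = t ≫ s

/-- Reversing arrows swaps the two halves of a splitting `(e, s)` and the two commuting squares, so
`lift` and `descend` trade places while the other two conditions are self-dual. -/
theorem SplitConsistent.op {C : Type*} [Category C] (hC : SplitConsistent C) :
    SplitConsistent Cᵒᵖ where
  factorization f := by
    obtain ⟨m, n, p, w, i, hp, hw, hw', hi, h⟩ := hC.factorization f.unop
    exact ⟨Opposite.op n, Opposite.op m, i.op, w.op, p.op, inferInstance, inferInstance,
      inferInstance, inferInstance, Quiver.Hom.unop_inj (by simp [h])⟩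
  exchange i p hi hp := by
    obtain ⟨m, p', i', hp', hi', h⟩ := hC.exchange p.unop i.unop
      (IsSplitMono.mk' ⟨(section_ p).unop, Quiver.Hom.op_inj (IsSplitEpi.id p)⟩)
      (IsSplitEpi.mk' ⟨(retraction i).unop, Quiver.Hom.op_inj (IsSplitMono.id i)⟩)
    exact ⟨Opposite.op m, i'.op, p'.op, inferInstance, inferInstance,
      Quiver.Hom.unop_inj (by simp [h])⟩
  lift w hw hw' e s h := by
    obtain ⟨k, e', s', t, h1, h2, h3⟩ := hC.descend w.unop inferInstance inferInstance
      s.unop e.unop (Quiver.Hom.op_inj h)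
    exact ⟨Opposite.op k, s'.op, e'.op, t.op, Quiver.Hom.unop_inj h1, Quiver.Hom.unop_inj h3.symm,
      Quiver.Hom.unop_inj h2.symm⟩
  descend w hw hw' e s h := by
    obtain ⟨k, e', s', t, h1, h2, h3⟩ := hC.lift w.unop inferInstance inferInstance
      s.unop e.unop (Quiver.Hom.op_inj h)
    exact ⟨Opposite.op k, s'.op, e'.op, t.op, Quiver.Hom.unop_inj h1, Quiver.Hom.unop_inj h3.symm,
      Quiver.Hom.unop_inj h2.symm⟩

/-- Every condition only asks for intermediate objects up to isomorphism, so these may be replaced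
by images of objects of `D`. -/
theorem SplitConsistent.of_isEquivalence {C D : Type*} [Category C] [Category D]
    (hC : SplitConsistent C) (F : D ⥤ C) [F.IsEquivalence] : SplitConsistent D where
  factorization {a b} f := by
    obtain ⟨m, n, p, w, i, hp, hw, hw', hi, h⟩ := hC.factorization (F.map f)
    let μ := F.objObjPreimageIso m
    let ν := F.objObjPreimageIso n
    refine ⟨_, _, F.preimage (p ≫ μ.inv), F.preimage (μ.hom ≫ w ≫ ν.inv), F.preimage (ν.hom ≫ i),
      ?_, ?_, ?_, ?_, F.map_injective (by simp [h])⟩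
    · rw [← F.isSplitEpi_iff, F.map_preimage]; infer_instance
    · refine F.mono_of_mono_map ?_
      rw [F.map_preimage]; infer_instance
    · refine F.epi_of_epi_map ?_
      rw [F.map_preimage]; infer_instance
    · rw [← F.isSplitMono_iff, F.map_preimage]; infer_instance
  exchange i p hi hp := by
    obtain ⟨m, p', i', hp', hi', h⟩ := hC.exchange (F.map i) (F.map p) inferInstance inferInstance
    let μ := F.objObjPreimageIso m
    refine ⟨_, F.preimage (p' ≫ μ.inv), F.preimage (μ.hom ≫ i'), ?_, ?_,
      F.map_injective (by simp [h])⟩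
    · rw [← F.isSplitEpi_iff, F.map_preimage]; infer_instance
    · rw [← F.isSplitMono_iff, F.map_preimage]; infer_instance
  lift w hw hw' e s h := by
    obtain ⟨k, e', s', t, h1, h2, h3⟩ := hC.lift (F.map w) inferInstance inferInstance
      (F.map e) (F.map s) (by rw [← F.map_comp, h, F.map_id])
    let μ := F.objObjPreimageIso k
    exact ⟨_, F.preimage (e' ≫ μ.inv), F.preimage (μ.hom ≫ s'), F.preimage (μ.hom ≫ t),
      F.map_injective (by simp [reassoc_of% h1]), F.map_injective (by simp [h2]),
      F.map_injective (by simp [h3])⟩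
  descend w hw hw' e s h := by
    obtain ⟨k, e', s', t, h1, h2, h3⟩ := hC.descend (F.map w) inferInstance inferInstance
      (F.map e) (F.map s) (by rw [← F.map_comp, h, F.map_id])
    let μ := F.objObjPreimageIso k
    exact ⟨_, F.preimage (e' ≫ μ.inv), F.preimage (μ.hom ≫ s'), F.preimage (t ≫ μ.inv),
      F.map_injective (by simp [reassoc_of% h1]), F.map_injective (by simp [reassoc_of% h2]),
      F.map_injective (by simp [h3])⟩

/-! ### Subobjects and their images under a morphism. -/

section Splitting

variable {C : Type u} [Category.{v} C] [CategoryWithSubobjects C]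

/-- An epic split inclusion is invertible, and its inverse is again an inclusion by `incl_of_comp`.
-/
theorem sub_of_epi_inclusion {a b : C} (h : a ⊑ b) [Epi (incl h)] {r : b ⟶ a}
    (hr : incl h ≫ r = 𝟙 a) : b ⊑ a := by
  have : r ≫ incl h = incl (sub_refl b) := by
    rw [← cancel_epi (incl h), ← Category.assoc, hr, incl_refl, Category.id_comp, Category.comp_id]
  exact (incl_of_comp _ _ _ this).choose

theorem InCore.sub {c x y : C} {f : x ⟶ y} (hf : InCore c f) : x ⊑ c ∧ y ⊑ c := by
  induction hf with
  | incl h hy => exact ⟨sub_trans h hy, hy⟩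
  | retraction q hq hy => exact ⟨hy, sub_trans hq.choose hy⟩
  | comp f g _ _ ihf ihg => exact ⟨ihf.1, ihg.2⟩

theorem IsRetraction.isSplitEpi {a m : C} {q : a ⟶ m} (hq : IsRetraction q) : IsSplitEpi q :=
  IsSplitEpi.mk' ⟨incl hq.choose, hq.choose_spec⟩

theorem Core.incl_sub {c : C} {x y : Core c} (h : x.obj ⊑ y.obj) :
    CategoryWithSubobjects.incl h ≫ CategoryWithSubobjects.incl y.sub =
      CategoryWithSubobjects.incl x.sub := incl_trans _ _

theorem Core.ext_obj {c : C} {x y : Core c} (h : x.obj = y.obj) : x = y := by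
  cases x
  cases y
  obtain rfl := h
  rfl

/-- `t : c' ⟶ d'` exhibits the subobject `d'` of `d` as the image of the subobject `c'` of `c`
under `w : c ⟶ d`. -/
structure IsCover {c d : C} (w : c ⟶ d) (x : Core c) (z : Core d) (t : x.obj ⟶ z.obj) : Prop where
  epi : Epi t
  comm : t ≫ incl z.sub = incl x.sub ≫ w

theorem IsCover.mono {c d : C} {w : c ⟶ d} [Mono w] {x : Core c} {z : Core d}
    {t : x.obj ⟶ z.obj} (ht : IsCover w x z t) : Mono t := by
  have : Mono (t ≫ incl z.sub) := by
    rw [ht.comm]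
    exact mono_comp _ _
  exact mono_of_mono _ (incl z.sub)

theorem IsCover.incl_comm {c d : C} {w : c ⟶ d} {x y : Core c} {z z' : Core d}
    {t : x.obj ⟶ z.obj} {s : y.obj ⟶ z'.obj} (ht : IsCover w x z t) (hs : IsCover w y z' s)
    (h : x.obj ⊑ y.obj)
    (k : z.obj ⊑ z'.obj) : t ≫ incl k = incl h ≫ s := by
  rw [← cancel_mono (incl z'.sub), Category.assoc, Core.incl_sub, ht.comm, Category.assoc, hs.comm,
    ← Category.assoc, Core.incl_sub]

end Splitting

/-! ### Epimorphic components and uniqueness of covers. -/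

section Factorizations

variable {C : Type u} [Category.{v} C] [CategoryWithSubobjects C] [HasConsistentFactorizations C]

instance epiPart_mono {a b : C} (f : a ⟶ b) [Mono f] : Mono (epiPart f) := by
  have : Mono (epiPart f ≫ incl (im_sub f)) := by rwa [epiPart_incl]
  exact mono_of_mono _ (incl (im_sub f))

theorem isIso_epiPart {a b : C} (s : a ⟶ b) [IsSplitMono s] : IsIso (epiPart s) := by
  have : IsSplitMono (epiPart s) := IsSplitMono.mk' ⟨incl (im_sub s) ≫ retraction s, by
    rw [← Category.assoc, epiPart_incl, IsSplitMono.id]⟩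
  exact isIso_of_epi_of_isSplitMono _

/-- A split monomorphism is an isomorphism followed by an inclusion. -/
theorem exists_iso_incl {a b : C} (s : a ⟶ b) [IsSplitMono s] :
    ∃ (n : C) (w : a ≅ n) (h : n ⊑ b), s = w.hom ≫ incl h := by
  have := isIso_epiPart s
  exact ⟨_, asIso (epiPart s), im_sub s, (epiPart_incl s).symm⟩

/-- The image of a subobject. -/
noncomputable def Core.image {c d : C} (w : c ⟶ d) (x : Core c) : Core d :=
  ⟨im (CategoryWithSubobjects.incl x.sub ≫ w), im_sub _⟩

/-- The epimorphism from a subobject to its image. -/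
noncomputable def Core.toImage {c d : C} (w : c ⟶ d) (x : Core c) : x.obj ⟶ (x.image w).obj :=
  epiPart (CategoryWithSubobjects.incl x.sub ≫ w)

theorem isCover_toImage {c d : C} (w : c ⟶ d) (x : Core c) :
    IsCover w x (x.image w) (x.toImage w) :=
  ⟨epiPart_epi _, epiPart_incl _⟩

namespace IsCover

variable {c d : C} {w : c ⟶ d} {x y : Core c} {z z' : Core d}
  {t : x.obj ⟶ z.obj} {s : y.obj ⟶ z'.obj}

theorem eq_image (ht : IsCover w x z t) : z = x.image w := by
  have := ht.epi
  exact Core.ext_obj (im_eq _ t z.sub ht.comm.symm).symm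

theorem of_image (hz : z.obj = (x.image w).obj) (ht : t ≫ incl z.sub = incl x.sub ≫ w) :
    IsCover w x z t := by
  obtain rfl : z = x.image w := Core.ext_obj hz
  have : t = x.toImage w := by
    rw [← cancel_mono (incl (x.image w).sub), ht, (isCover_toImage w x).comm]
  rw [this]
  exact isCover_toImage w x

theorem sub (ht : IsCover w x z t) (hs : IsCover w y z' s) (h : x.obj ⊑ y.obj) :
    z.obj ⊑ z'.obj := by
  have := ht.epi
  refine sub_of_epi_incl t (incl h ≫ s) z.sub z'.sub ?_
  rw [ht.comm, Category.assoc, hs.comm, ← Category.assoc, Core.incl_sub]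

end IsCover

/-- The data of the functor that makes `w` consistent, in terms of covers. -/
theorem IsConsistentBimorphism.exists_functor {c d : C} {w : c ⟶ d}
    (hw : IsConsistentBimorphism w) : ∃ (T : Core c ⥤ Core d)
      (t : ∀ x : Core c, x.obj ⟶ (T.obj x).obj), IsCategoryIso T ∧
      (∀ x, IsCover w x (T.obj x) (t x)) ∧
      ∀ (x y : Core c) (f : x ⟶ y), f.1 ≫ t y = t x ≫ (T.map f).1 := by
  obtain ⟨T, ⟨hT, hiso, τ, hτ⟩, -⟩ := hw
  exact ⟨T, fun x => τ.app x, hiso, fun x => IsCover.of_image (hT.1 x) (hτ x),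
    fun x y f => τ.naturality f⟩

end Factorizations

/-! ### A consistent category is split consistent -/

section Necessary

variable {C : Type u} [Category.{v} C] [CategoryWithSubobjects C] [HasConsistentFactorizations C]
  {c d : C} {w : c ⟶ d}

/-- The retraction `r` is a morphism of `⟨c⟩`; `T r` is the retraction sought, and naturality is the
commuting square. -/
theorem IsConsistentBimorphism.descend_retraction (hw : IsConsistentBimorphism w) [Epi w]
    (x : Core c) (r : c ⟶ x.obj) (hr : incl x.sub ≫ r = 𝟙 _) :
    ∃ (z : Core d) (t : x.obj ⟶ z.obj) (g : d ⟶ z.obj), incl z.sub ≫ g = 𝟙 _ ∧ r ≫ t = w ≫ g ∧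
      t ≫ incl z.sub = incl x.sub ≫ w := by
  obtain ⟨T, t, -, ht, hnat⟩ := hw.exists_functor
  let c' : Core c := ⟨c, sub_refl c⟩
  let ρ : c' ⟶ x := ⟨r, InCore.retraction r ⟨x.sub, hr⟩ (sub_refl c)⟩
  have hc : t c' ≫ incl (T.obj c').sub = w := by
    rw [(ht c').comm, show incl c'.sub = 𝟙 c from incl_refl c, Category.id_comp]
  -- `T` sends the top object to the image of `w`. As `w` is epi, the inclusion of that image is epi
  -- and split, hence it is all of `d`.
  have : Epi (incl (T.obj c').sub) := by
    have : Epi (t c' ≫ incl (T.obj c').sub) := by rwa [hc]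
    exact epi_of_epi (t c') _
  obtain ⟨p, hp⟩ := HasConsistentFactorizations.incl_splits (T.obj c').sub
  have k := sub_of_epi_inclusion _ hp
  have hk : w ≫ incl k = t c' := by
    rw [← cancel_mono (incl (T.obj c').sub), hc, Category.assoc, incl_trans, incl_refl,
      Category.comp_id]
  have hg : r ≫ t x = w ≫ incl k ≫ (T.map ρ).1 := by
    rw [← Category.assoc, hk]
    exact hnat _ _ ρ
  refine ⟨T.obj x, t x, incl k ≫ (T.map ρ).1, ?_, hg, (ht x).comm⟩
  have := (ht x).epi
  rw [← cancel_epi (t x), ← Category.assoc, (ht x).comm, Category.assoc, ← hg, ← Category.assoc, hr,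
    Category.id_comp, Category.comp_id]

/-- Since `T` is an isomorphism, the subobject `z` and the retraction onto it both have preimages in
`⟨c⟩`. -/
theorem IsConsistentBimorphism.lift_retraction (hw : IsConsistentBimorphism w) [Mono w]
    (z : Core d) (g : d ⟶ z.obj) (hg : incl z.sub ≫ g = 𝟙 _) :
    ∃ (x : Core c) (t : x.obj ⟶ z.obj) (r : c ⟶ x.obj), incl x.sub ≫ r = 𝟙 _ ∧ r ≫ t = w ≫ g ∧
      t ≫ incl z.sub = incl x.sub ≫ w := by
  obtain ⟨T, t, hiso, ht, hnat⟩ := hw.exists_functor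
  have := hiso.isEquivalence
  obtain ⟨x, rfl⟩ := hiso.bijective_obj.2 z
  let c' : Core c := ⟨c, sub_refl c⟩
  have hc : t c' ≫ incl (T.obj c').sub = w := by
    rw [(ht c').comm, show incl c'.sub = 𝟙 c from incl_refl c, Category.id_comp]
  let γ : T.obj c' ⟶ T.obj x := ⟨incl (T.obj c').sub ≫ g,
    InCore.comp _ _ (InCore.incl _ (sub_refl d))
      (InCore.retraction g ⟨(T.obj x).sub, hg⟩ (sub_refl d))⟩
  have hr : (T.preimage γ).1 ≫ t x = w ≫ g := by
    rw [hnat, T.map_preimage, ← hc, Category.assoc]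
  refine ⟨x, t x, (T.preimage γ).1, ?_, hr, (ht x).comm⟩
  have := (ht x).mono
  rw [← cancel_mono (t x), Category.assoc, hr, ← Category.assoc, ← (ht x).comm, Category.assoc, hg,
    Category.comp_id, Category.id_comp]

/-- A split epimorphism with section `s` is a retraction followed by an isomorphism. -/
theorem exists_retraction_iso {a m : C} (e : a ⟶ m) (s : m ⟶ a) (h : s ≫ e = 𝟙 m) :
    ∃ (n : C) (w : m ≅ n) (k : n ⊑ a), s = w.hom ≫ incl k ∧ incl k ≫ e ≫ w.hom = 𝟙 n := by
  have : IsSplitMono s := IsSplitMono.mk' ⟨e, h⟩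
  obtain ⟨n, w, k, rfl⟩ := exists_iso_incl s
  refine ⟨n, w, k, rfl, ?_⟩
  rw [← cancel_epi w.hom, ← Category.assoc, ← Category.assoc, h, Category.id_comp, Category.comp_id]

theorem splitConsistent (C : Type u) [Category.{v} C] [CategoryWithSubobjects C]
    [ConsistentCategory C] : SplitConsistent C where
  factorization f := by
    obtain ⟨n, e, h, ⟨m, q, w, hq, hw, rfl⟩, rfl⟩ := HasConsistentFactorizations.factorization f
    obtain ⟨r, hr⟩ := HasConsistentFactorizations.incl_splits h
    exact ⟨m, n, q, w, incl h, hq.isSplitEpi, hw.1, hw.2, IsSplitMono.mk' ⟨r, hr⟩, by simp⟩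
  exchange i p hi hp := by
    -- Up to isomorphisms at the outer ends, `i ≫ p` is an inclusion followed by a retraction, so
    -- normal factorisation applies.
    obtain ⟨n, w, k, h1, h2⟩ := exists_retraction_iso p (section_ p) (IsSplitEpi.id p)
    obtain ⟨n', w', k', rfl⟩ := exists_iso_incl i
    obtain ⟨l, e, h, ⟨m, q, u, hq, hu, rfl⟩, hf⟩ :=
      ConsistentCategory.normal_factorization k' (p ≫ w.hom) ⟨k, h2⟩
    obtain ⟨r, hr⟩ := HasConsistentFactorizations.incl_splits h
    have := hq.isSplitEpi
    have : IsSplitMono (incl h) := IsSplitMono.mk' ⟨r, hr⟩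
    refine ⟨l, w'.hom ≫ q ≫ u, incl h ≫ w.inv, inferInstance, inferInstance, ?_⟩
    have := congrArg (fun f => f ≫ w.inv) hf
    simp only [Category.assoc, Iso.hom_inv_id, Category.comp_id] at this
    simp [this]
  lift w hw hw' e s h := by
    obtain ⟨n, v, k, rfl, h2⟩ := exists_retraction_iso e s h
    obtain ⟨x, t, r, h3, h4, h5⟩ := (ConsistentCategory.bimorphism_consistent w
      ⟨hw, hw'⟩).lift_retraction ⟨n, k⟩ (e ≫ v.hom) h2
    refine ⟨x.obj, r, incl x.sub, t ≫ v.inv, h3, ?_, ?_⟩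
    · simp [reassoc_of% h4]
    · simp [h5]
  descend w hw hw' e s h := by
    obtain ⟨n, v, k, rfl, h2⟩ := exists_retraction_iso e s h
    obtain ⟨z, t, g, h3, h4, h5⟩ := (ConsistentCategory.bimorphism_consistent w
      ⟨hw, hw'⟩).descend_retraction ⟨n, k⟩ (e ≫ v.hom) h2
    refine ⟨z.obj, g, incl z.sub, v.hom ≫ t, h3, ?_, ?_⟩
    · simpa using h4
    · simp [h5]

end Necessary

/-! ### A split consistent category with subobjects is consistent -/

section Sufficient

variable {C : Type u} [Category.{v} C] [CategoryWithSubobjects C]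

section Covers

variable [HasConsistentFactorizations C] {c d : C} {w : c ⟶ d}

/-- The abstract splitting provided by `descend` is realised on a genuine subobject of `d`, which
must be `z` because covers are unique. -/
theorem SplitConsistent.descend_retraction (hC : SplitConsistent C) [Mono w] [Epi w] {x : Core c}
    {z : Core d} {t : x.obj ⟶ z.obj} (ht : IsCover w x z t) (r : c ⟶ x.obj)
    (hr : incl x.sub ≫ r = 𝟙 _) : ∃ g : d ⟶ z.obj, incl z.sub ≫ g = 𝟙 _ ∧ w ≫ g = r ≫ t := by
  obtain ⟨k, e, s, u, h1, h2, h3⟩ := hC.descend w inferInstance inferInstance r (incl x.sub) hr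
  obtain ⟨n, v, l, rfl, h4⟩ := exists_retraction_iso e s h1
  have hu : IsCover w x ⟨n, l⟩ (u ≫ v.hom) :=
    { epi := by
        have : Epi (r ≫ u) := by
          rw [h2]
          have : IsSplitEpi e := IsSplitEpi.mk' ⟨_, h1⟩
          exact epi_comp _ _
        have : Epi u := epi_of_epi r u
        exact epi_comp _ _
      comm := by simp [h3] }
  obtain rfl := ht.eq_image.trans hu.eq_image.symm
  obtain rfl : t = u ≫ v.hom := by
    rw [← cancel_mono (incl l)]
    exact ht.comm.trans hu.comm.symm
  exact ⟨e ≫ v.hom, h4, by simp [reassoc_of% h2]⟩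

theorem SplitConsistent.lift_retraction (hC : SplitConsistent C) [Mono w] [Epi w]
    (z : Core d) (g : d ⟶ z.obj) (hg : incl z.sub ≫ g = 𝟙 _) :
    ∃ (x : Core c) (t : x.obj ⟶ z.obj) (r : c ⟶ x.obj), IsCover w x z t ∧
      incl x.sub ≫ r = 𝟙 _ ∧ r ≫ t = w ≫ g := by
  obtain ⟨k, e, s, u, h1, h2, h3⟩ := hC.lift w inferInstance inferInstance g (incl z.sub) hg
  obtain ⟨n, v, l, rfl, h4⟩ := exists_retraction_iso e s h1
  refine ⟨⟨n, l⟩, v.inv ≫ u, e ≫ v.hom, ⟨?_, ?_⟩, h4, by simp [h2]⟩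
  · have : Epi (e ≫ u) := by
      rw [h2]
      have : IsSplitEpi g := IsSplitEpi.mk' ⟨_, hg⟩
      exact epi_comp _ _
    have : Epi u := epi_of_epi e u
    exact epi_comp _ _
  · simp [← h3]

theorem Core.exists_retraction (x : Core c) : ∃ r : c ⟶ x.obj,
    CategoryWithSubobjects.incl x.sub ≫ r = 𝟙 _ :=
  HasConsistentFactorizations.incl_splits x.sub

theorem SplitConsistent.exists_cover (hC : SplitConsistent C) [Mono w] [Epi w] (z : Core d) :
    ∃ (x : Core c) (t : x.obj ⟶ z.obj), IsCover w x z t := by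
  obtain ⟨g, hg⟩ := z.exists_retraction
  obtain ⟨x, t, -, ht, -⟩ := hC.lift_retraction (w := w) z g hg
  exact ⟨x, t, ht⟩

variable {x y : Core c} {z z' : Core d} {t : x.obj ⟶ z.obj} {s : y.obj ⟶ z'.obj}

/-- A retraction onto `y` descends to one onto `z'`, which fixes `z`. Cancelling the monomorphism
`w` shows that the retraction onto `y` fixes `x`, so `x` lies below `y`. -/
theorem SplitConsistent.sub_of_cover (hC : SplitConsistent C) [Mono w] [Epi w]
    (ht : IsCover w x z t) (hs : IsCover w y z' s) (h : z.obj ⊑ z'.obj) : x.obj ⊑ y.obj := by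
  obtain ⟨r, hr⟩ := y.exists_retraction
  obtain ⟨g, hg, hg'⟩ := hC.descend_retraction hs r hr
  have key : (incl x.sub ≫ r) ≫ incl y.sub = incl x.sub := by
    rw [← cancel_mono w, Category.assoc, Category.assoc, ← hs.comm, ← Category.assoc r, ← hg',
      ← Category.assoc, ← Category.assoc, ← ht.comm, ← Core.incl_sub h, Category.assoc t,
      Category.assoc (incl h), hg, Category.comp_id, Category.assoc, Core.incl_sub h]
  exact (incl_of_comp _ _ _ key).choose

theorem SplitConsistent.eq_of_cover (hC : SplitConsistent C) [Mono w] [Epi w]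
    {s : y.obj ⟶ z.obj} (ht : IsCover w x z t) (hs : IsCover w y z s) : x = y :=
  Core.ext_obj (sub_antisymm (hC.sub_of_cover ht hs (sub_refl _))
    (hC.sub_of_cover hs ht (sub_refl _)))

/-- The morphisms of `⟨c⟩` descend along covers. -/
theorem SplitConsistent.descend_core (hC : SplitConsistent C) [Mono w] [Epi w] {a b : C}
    {f : a ⟶ b} (hf : InCore c f) : ∀ (ha : a ⊑ c) (hb : b ⊑ c) (z z' : Core d) (t : a ⟶ z.obj)
      (s : b ⟶ z'.obj), IsCover w ⟨a, ha⟩ z t → IsCover w ⟨b, hb⟩ z' s →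
      ∃ g : z.obj ⟶ z'.obj, InCore d g ∧ t ≫ g = f ≫ s := by
  induction hf with
  | incl h _ =>
    intro _ _ z z' t s ht hs
    have k := ht.sub hs h
    exact ⟨incl k, InCore.incl k z'.sub, ht.incl_comm hs h k⟩
  | @retraction x y q hq _ =>
    intro hy hx z z' t s ht hs
    obtain ⟨h, hh⟩ := hq
    -- Splittings descend only from the whole of `c`, so `q` is first extended to `c` along a
    -- retraction `p` and the result is restricted to `z` afterwards.
    obtain ⟨p, hp⟩ := HasConsistentFactorizations.incl_splits hy
    obtain ⟨g, hg, hg'⟩ := hC.descend_retraction hs (p ≫ q) (by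
      rw [← incl_trans h hy, Category.assoc, ← Category.assoc (incl hy), hp, Category.id_comp, hh])
    have k := hs.sub ht h
    refine ⟨incl z.sub ≫ g, InCore.retraction _ ⟨k, ?_⟩ z.sub, ?_⟩
    · rw [← Category.assoc, Core.incl_sub k, hg]
    · rw [← Category.assoc, ht.comm, Category.assoc, hg', ← Category.assoc, ← Category.assoc, hp,
        Category.id_comp]
  | comp f f' hf _ ihf ihf' =>
    intro hx hz z z' t s ht hs
    have hc := isCover_toImage w ⟨_, hf.sub.2⟩
    obtain ⟨g, hg, e⟩ := ihf hx _ _ _ _ _ ht hc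
    obtain ⟨g', hg', e'⟩ := ihf' _ hz _ _ _ _ hc hs
    exact ⟨g ≫ g', InCore.comp _ _ hg hg', by
      rw [← Category.assoc, e, Category.assoc, e', Category.assoc]⟩

/-- The morphisms of `⟨d⟩` lift along covers. -/
theorem SplitConsistent.lift_core (hC : SplitConsistent C) [Mono w] [Epi w] {a b : C}
    {g : a ⟶ b} (hg : InCore d g) : ∀ (ha : a ⊑ d) (hb : b ⊑ d) (x y : Core c) (t : x.obj ⟶ a)
      (s : y.obj ⟶ b), IsCover w x ⟨a, ha⟩ t → IsCover w y ⟨b, hb⟩ s →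
      ∃ f : x.obj ⟶ y.obj, InCore c f ∧ f ≫ s = t ≫ g := by
  induction hg with
  | incl h _ =>
    intro _ _ x y t s ht hs
    have k := hC.sub_of_cover ht hs h
    exact ⟨incl k, InCore.incl k y.sub, (ht.incl_comm hs k h).symm⟩
  | @retraction x' y' q hq _ =>
    intro hy hx y x t s ht hs
    obtain ⟨h, hh⟩ := hq
    -- As in the descent, `q` is extended to the whole of `d`. The cover found by lifting agrees
    -- with the given one by uniqueness.
    obtain ⟨p, hp⟩ := HasConsistentFactorizations.incl_splits hy
    obtain ⟨x₁, s₁, r, hs₁, hr, hr'⟩ := hC.lift_retraction (w := w) ⟨x', hx⟩ (p ≫ q) (by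
      change incl hx ≫ p ≫ q = 𝟙 x'
      rw [← incl_trans h hy, Category.assoc, ← Category.assoc (incl hy), hp, Category.id_comp, hh])
    obtain rfl := hC.eq_of_cover hs hs₁
    obtain rfl : s = s₁ := by
      rw [← cancel_mono (incl hx)]
      exact hs.comm.trans hs₁.comm.symm
    have k := hC.sub_of_cover hs ht h
    refine ⟨incl y.sub ≫ r, InCore.retraction _ ⟨k, ?_⟩ y.sub, ?_⟩
    · rw [← Category.assoc, Core.incl_sub k, hr]
    · have h1 : t ≫ incl hy = incl y.sub ≫ w := ht.comm
      rw [Category.assoc, hr', ← Category.assoc, ← h1, Category.assoc, ← Category.assoc (incl hy),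
        hp, Category.id_comp]
  | comp g g' hg _ ihg ihg' =>
    intro hx hz x y t s ht hs
    -- The middle object of a composite in `⟨d⟩` is a subobject of `d`, and every such subobject is
    -- covered.
    obtain ⟨m, u, hu⟩ := hC.exists_cover (w := w) ⟨_, hg.sub.2⟩
    obtain ⟨f, hf, e⟩ := ihg hx _ _ _ _ _ ht hu
    obtain ⟨f', hf', e'⟩ := ihg' _ hz _ _ _ _ hu hs
    exact ⟨f ≫ f', InCore.comp _ _ hf hf', by
      rw [Category.assoc, e', ← Category.assoc, e, Category.assoc]⟩

theorem exists_image_map (hC : SplitConsistent C) [Mono w] [Epi w] (f : x ⟶ y) :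
    ∃ g : x.image w ⟶ y.image w, x.toImage w ≫ g.1 = f.1 ≫ y.toImage w := by
  obtain ⟨g, hg, h⟩ := hC.descend_core (w := w) f.2 x.sub y.sub _ _ _ _ (isCover_toImage w x)
    (isCover_toImage w y)
  exact ⟨⟨g, hg⟩, h⟩

/-- The isomorphism `⟨c⟩ ⥤ ⟨d⟩` induced by a bimorphism `c ⟶ d`. -/
noncomputable def imageFunctor (hC : SplitConsistent C) (w : c ⟶ d) [Mono w] [Epi w] :
    Core c ⥤ Core d where
  obj x := x.image w
  map f := (exists_image_map hC f).choose
  map_id x := by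
    have := (isCover_toImage w x).epi
    refine Subtype.ext ((cancel_epi (x.toImage w)).1 ?_)
    rw [(exists_image_map hC (𝟙 x)).choose_spec]
    exact (Category.id_comp _).trans (Category.comp_id _).symm
  map_comp {x y z} f g := by
    have := (isCover_toImage w x).epi
    refine Subtype.ext ((cancel_epi (x.toImage w)).1 ?_)
    rw [(exists_image_map hC (f ≫ g)).choose_spec]
    change (f.1 ≫ g.1) ≫ _ = x.toImage w ≫ (exists_image_map hC f).choose.1 ≫
      (exists_image_map hC g).choose.1
    rw [← Category.assoc, (exists_image_map hC f).choose_spec, Category.assoc, Category.assoc,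
      (exists_image_map hC g).choose_spec]

theorem toImage_imageFunctor_map (hC : SplitConsistent C) (w : c ⟶ d) [Mono w] [Epi w]
    (f : x ⟶ y) : x.toImage w ≫ ((imageFunctor hC w).map f).1 = f.1 ≫ y.toImage w :=
  (exists_image_map hC f).choose_spec

/-- Faithful because covers are mono, full by `lift_core`, and bijective on objects because each
subobject of `d` is covered by exactly one subobject of `c`. -/
theorem isCategoryIso_imageFunctor (hC : SplitConsistent C) (w : c ⟶ d) [Mono w] [Epi w] :
    IsCategoryIso (imageFunctor hC w) := by
  have : (imageFunctor hC w).Faithful := ⟨fun {x y f g} h => by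
    have := (isCover_toImage w y).mono
    refine Subtype.ext ((cancel_mono (y.toImage w)).1 ?_)
    rw [← toImage_imageFunctor_map hC, ← toImage_imageFunctor_map hC, h]⟩
  have : (imageFunctor hC w).Full := ⟨fun {x y} g => by
    obtain ⟨f, hf, h⟩ := hC.lift_core g.2 (x.image w).sub (y.image w).sub x y _ _
      (isCover_toImage w x) (isCover_toImage w y)
    have := (isCover_toImage w x).epi
    exact ⟨⟨f, hf⟩, Subtype.ext ((cancel_epi (x.toImage w)).1
      ((toImage_imageFunctor_map hC w ⟨f, hf⟩).trans h))⟩⟩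
  refine isCategoryIso_of_bijective _ ⟨fun x y h => ?_, fun z => ?_⟩
  · have hx := isCover_toImage w x
    have h' : x.image w = y.image w := h
    generalize x.toImage w = t at hx
    revert t
    rw [h']
    exact fun t hx => hC.eq_of_cover hx (isCover_toImage w y)
  · obtain ⟨x, t, ht⟩ := hC.exists_cover (w := w) z
    exact ⟨x, ht.eq_image.symm⟩

/-- Uniqueness of covers fixes the objects and the components `t`; since these are epi, naturality
then fixes the morphisms. -/
theorem functor_ext_of_cover {T T' : Core c ⥤ Core d} {t : ∀ x : Core c, x.obj ⟶ (T.obj x).obj}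
    {t' : ∀ x : Core c, x.obj ⟶ (T'.obj x).obj} (ht : ∀ x, IsCover w x (T.obj x) (t x))
    (ht' : ∀ x, IsCover w x (T'.obj x) (t' x))
    (h : ∀ (x y : Core c) (f : x ⟶ y), f.1 ≫ t y = t x ≫ (T.map f).1)
    (h' : ∀ (x y : Core c) (f : x ⟶ y), f.1 ≫ t' y = t' x ≫ (T'.map f).1) : T = T' := by
  have hobj : T.obj = T'.obj := funext fun x => (ht x).eq_image.trans (ht' x).eq_image.symm
  obtain ⟨o, m, _, _⟩ := T
  obtain ⟨o', m', _, _⟩ := T'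
  obtain rfl : o = o' := hobj
  obtain rfl : t = t' := funext fun x => by
    rw [← cancel_mono (incl (o x).sub)]
    exact (ht x).comm.trans (ht' x).comm.symm
  obtain rfl : @m = @m' := by
    funext x y f
    have := (ht x).epi
    exact Subtype.ext ((cancel_epi (t x)).1 ((h x y f).symm.trans (h' x y f)))
  rfl

theorem SplitConsistent.isConsistentBimorphism (hC : SplitConsistent C) (hw : IsBimorphism w) :
    IsConsistentBimorphism w := by
  have := hw.1
  have := hw.2
  refine ⟨imageFunctor hC w, ⟨⟨fun x => rfl, fun x y h => ?_⟩, isCategoryIso_imageFunctor hC w,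
    ⟨fun x => x.toImage w, fun x y f => (toImage_imageFunctor_map hC w f).symm⟩,
    fun x => (isCover_toImage w x).comm⟩, ?_⟩
  · have hx := isCover_toImage w x
    have k := hx.sub (isCover_toImage w y) h
    have := hx.epi
    exact ⟨k, Subtype.ext ((cancel_epi (x.toImage w)).1 ((toImage_imageFunctor_map hC w _).trans
      (hx.incl_comm (isCover_toImage w y) h k).symm))⟩
  · rintro T ⟨hT, -, τ, hτ⟩
    exact functor_ext_of_cover (t := fun x => τ.app x) (t' := fun x => x.toImage w)
      (fun x => IsCover.of_image (hT.1 x) (hτ x)) (isCover_toImage w)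
      (fun x y f => τ.naturality f) (fun x y f => (toImage_imageFunctor_map hC w f).symm)

end Covers

/-- A split consistent category with subobjects is consistent, provided that inclusions split, that
split monomorphisms are inclusions up to isomorphism, and that there are enough cones. -/
theorem SplitConsistent.consistentCategory (hC : SplitConsistent C)
    (hsplit : ∀ {a b : C} (h : a ⊑ b), ∃ q : b ⟶ a, incl h ≫ q = 𝟙 a)
    (hincl : ∀ {a b : C} (s : a ⟶ b), IsSplitMono s →
      ∃ (n : C) (w : a ≅ n) (h : n ⊑ b), s = w.hom ≫ incl h)
    (hcone : ∀ c : C, ∃ ε : ConsistentCone C, ∃ h : ε.vertex = c, ε.app c ≫ eqToHom h = 𝟙 c) :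
    ConsistentCategory C := by
  -- Dually to `hincl`: turning a section of `p` into an inclusion makes `p` a retraction followed
  -- by an isomorphism.
  have hepi : ∀ {a m : C} (p : a ⟶ m), IsSplitEpi p →
      ∃ (n : C) (q : a ⟶ n) (v : n ≅ m), IsRetraction q ∧ p = q ≫ v.hom := by
    intro a m p hp
    obtain ⟨n, v, h, hv⟩ := hincl (section_ p) inferInstance
    have h1 : v.hom ≫ incl h ≫ p = 𝟙 m := by
      rw [← Category.assoc, ← hv, IsSplitEpi.id]
    refine ⟨n, p ≫ v.hom, v.symm, ⟨h, ?_⟩, by simp⟩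
    rw [← cancel_epi v.hom, reassoc_of% h1, Category.comp_id]
  have hfact : HasConsistentFactorizations C :=
    { incl_splits := hsplit
      factorization := fun f => by
        obtain ⟨m, n, p, w, i, hp, hw, hw', hi, rfl⟩ := hC.factorization f
        obtain ⟨m', q, v, hq, rfl⟩ := hepi p hp
        obtain ⟨n', v', h, rfl⟩ := hincl i hi
        exact ⟨n', q ≫ v.hom ≫ w ≫ v'.hom, h, ⟨m', q, v.hom ≫ w ≫ v'.hom, hq,
          ⟨inferInstance, inferInstance⟩, rfl⟩, by simp⟩ }
  exact
    { hfact with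
      bimorphism_consistent := fun w hw => hC.isConsistentBimorphism hw
      normal_factorization := fun h q hq => by
        obtain ⟨r, hr⟩ := hsplit h
        obtain ⟨m, p, i, hp, hi, hpi⟩ := hC.exchange (incl h) q (IsSplitMono.mk' ⟨r, hr⟩)
          hq.isSplitEpi
        obtain ⟨m', q', v, hq', rfl⟩ := hepi p hp
        obtain ⟨n', v', h', rfl⟩ := hincl i hi
        exact ⟨n', q' ≫ v.hom ≫ v'.hom, h', ⟨m', q', v.hom ≫ v'.hom, hq', inferInstance, rfl⟩,
          by rw [← hpi]; simp⟩
      exists_cone := hcone }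

end Sufficient

/-! ### Principal right ideals -/

section RightIdeals

variable {S : Type u} [Semigroup S]

theorem RightIdeals.exists_eq_of (A : RightIdeals S) :
    ∃ (e : S) (he : IsIdempotentElem e), A = RightIdeals.of e he := by
  obtain ⟨A, e, he, rfl⟩ := A
  exact ⟨e, he, rfl⟩

theorem RightIdeals.mem_of {e : S} (he : IsIdempotentElem e) {x : S} :
    x ∈ (RightIdeals.of e he).carrier ↔ e * x = x := by
  constructor
  · rintro ⟨t, rfl⟩
    change e * (e * t) = e * t
    rw [← mul_assoc, he.eq]
  · exact fun h => ⟨x, h⟩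

theorem RightIdeals.self_mem {e : S} (he : IsIdempotentElem e) :
    e ∈ (RightIdeals.of e he).carrier := ⟨e, he.eq⟩

theorem RightIdeals.of_subset_of {e f : S} (he : IsIdempotentElem e) (hf : IsIdempotentElem f) :
    (RightIdeals.of e he).carrier ⊆ (RightIdeals.of f hf).carrier ↔ f * e = e := by
  refine ⟨fun h => (mem_of hf).1 (h (self_mem he)), fun h x hx => ?_⟩
  rw [mem_of] at hx ⊢
  rw [← hx, ← mul_assoc, h]

theorem RightIdeals.hom_ext {A B : RightIdeals S} {φ ψ : A ⟶ B}
    (h : ∀ x, (φ.1 x : S) = ψ.1 x) : φ = ψ :=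
  Subtype.ext (funext fun x => Subtype.ext (h x))

/-- A morphism of `ℝ(S)` is left multiplication by the image of a generator. -/
theorem RightIdeals.hom_apply {A B : RightIdeals S} (φ : A ⟶ B) {e : S} (he : e ∈ A.carrier)
    (x : A.carrier) (hx : e * x = x) : (φ.1 x : S) = φ.1 ⟨e, he⟩ * x := by
  obtain ⟨-, -, s, -, -, -, -, -, h⟩ := φ.2
  rw [h, h, mul_assoc, hx]

theorem RightIdeals.hom_mul {A B : RightIdeals S} (φ : A ⟶ B) {e : S} (he : IsIdempotentElem e)
    (hA : e ∈ A.carrier) : (φ.1 ⟨e, hA⟩ : S) * e = φ.1 ⟨e, hA⟩ :=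
  (hom_apply φ hA ⟨e, hA⟩ he.eq).symm

/-- Left multiplication by `s ∈ fSe`, as a morphism `eS ⟶ fS`. -/
def RightIdeals.leftMul {e f : S} (he : IsIdempotentElem e) (hf : IsIdempotentElem f) (s : S)
    (h : f * s = s) (h' : s * e = s) : RightIdeals.of e he ⟶ RightIdeals.of f hf :=
  lam he hf s ⟨s, by rw [h, h']⟩

theorem RightIdeals.incl_splits {A B : RightIdeals S} (h : A ⊑ B) :
    ∃ q : B ⟶ A, incl h ≫ q = 𝟙 A := by
  obtain ⟨e, he, rfl⟩ := A.exists_eq_of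
  obtain ⟨f, hf, rfl⟩ := B.exists_eq_of
  have hfe := (of_subset_of he hf).1 h
  -- On `fS`, multiplication by `e` is multiplication by `ef`, which lies in `eSf` as required.
  refine ⟨leftMul hf he (e * f) (by rw [← mul_assoc, he.eq]) (by rw [mul_assoc, hf.eq]),
    hom_ext fun x => ?_⟩
  change e * f * x.1 = x.1
  rw [mul_assoc, (mem_of hf).1 (h x.2), (mem_of he).1 x.2]

/-- If `φ` and its retraction are left multiplications by `s` and `t`, then `ts = e`. Hence `st` is
idempotent, and `s`, `t` give inverse bijections between `eS` and `stS`. -/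
theorem RightIdeals.exists_iso_incl {A B : RightIdeals S} (φ : A ⟶ B) (hφ : IsSplitMono φ) :
    ∃ (Z : RightIdeals S) (w : A ≅ Z) (h : Z ⊑ B), φ = w.hom ≫ incl h := by
  obtain ⟨⟨ψ, hψ⟩⟩ := hφ
  obtain ⟨e, he, rfl⟩ := A.exists_eq_of
  obtain ⟨f, hf, rfl⟩ := B.exists_eq_of
  obtain ⟨s, hs⟩ : ∃ s, s = φ.1 ⟨e, self_mem he⟩ := ⟨_, rfl⟩
  obtain ⟨t, ht⟩ : ∃ t, t = ψ.1 ⟨f, self_mem hf⟩ := ⟨_, rfl⟩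
  have hse : s.1 * e = s := by rw [hs]; exact hom_mul φ he _
  have htf : t.1 * f = t := by rw [ht]; exact hom_mul ψ hf _
  have hfs : f * s.1 = s := (mem_of hf).1 s.2
  have het : e * t.1 = t := (mem_of he).1 t.2
  have hφ' : ∀ x, (φ.1 x : S) = s * x := fun x => by
    rw [hs]; exact hom_apply φ _ x ((mem_of he).1 x.2)
  have hts : t.1 * s.1 = e := by
    have h1 : ψ.1 (φ.1 ⟨e, self_mem he⟩) = ⟨e, self_mem he⟩ :=
      congrFun (congrArg Subtype.val hψ) _
    rw [← hs] at h1
    have h2 := hom_apply ψ (self_mem hf) s hfs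
    rw [h1, ← ht] at h2
    exact h2.symm
  have hst : IsIdempotentElem (s.1 * t.1) := by
    change s.1 * t.1 * (s.1 * t.1) = s.1 * t.1
    rw [mul_assoc, ← mul_assoc t.1, hts, het]
  refine ⟨of (s.1 * t.1) hst,
    ⟨leftMul he hst s (by rw [mul_assoc, hts, hse]) hse,
      leftMul hst he t het (by rw [← mul_assoc, hts, het]), hom_ext fun x => ?_,
      hom_ext fun x => ?_⟩, (of_subset_of hst hf).2 (by rw [← mul_assoc, hfs]),
    hom_ext fun x => hφ' x⟩
  · change t.1 * (s.1 * x.1) = x.1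
    rw [← mul_assoc, hts, (mem_of he).1 x.2]
  · change s.1 * (t.1 * x.1) = x.1
    rw [← mul_assoc, (mem_of hst).1 x.2]

/-- The cone is left multiplication by `e` on every ideal. -/
theorem RightIdeals.exists_cone (A : RightIdeals S) :
    ∃ γ : ConsistentCone (RightIdeals S), ∃ h : γ.vertex = A, γ.app A ≫ eqToHom h = 𝟙 A := by
  obtain ⟨e, he, rfl⟩ := A.exists_eq_of
  have happ : ∀ B : RightIdeals S, ∃ φ : B ⟶ of e he, ∀ x, (φ.1 x : S) = e * x := fun B => by
    obtain ⟨f, hf, rfl⟩ := B.exists_eq_of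
    refine ⟨leftMul hf he (e * f) (by rw [← mul_assoc, he.eq]) (by rw [mul_assoc, hf.eq]),
      fun x => ?_⟩
    change e * f * x.1 = e * x.1
    rw [mul_assoc, (mem_of hf).1 x.2]
  choose app happ using happ
  have hid : app (of e he) = 𝟙 _ := hom_ext fun x => (happ _ x).trans ((mem_of he).1 x.2)
  refine ⟨⟨of e he, app, fun h => hom_ext fun x => ?_, of e he, ?_⟩, rfl, ?_⟩
  · exact (happ _ _).trans (happ _ x).symm
  · rw [hid]
    exact ⟨inferInstance, inferInstance⟩
  · change app (of e he) ≫ 𝟙 _ = _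
    rw [hid, Category.comp_id]

end RightIdeals

open ConsistentCone

/-! ### Cones and the values of the `H`-functors -/

section Cones

variable {C : Type u} [Category.{v} C] [CategoryWithSubobjects C] [HasConsistentFactorizations C]

theorem ConsistentCone.star_id (γ : ConsistentCone C) : γ.star (𝟙 γ.vertex) = γ :=
  ext' rfl fun _ => heq_of_eq (Category.comp_id _)

/-- Reduces an equality of cones to an equality of morphisms into a common object `b`. -/
theorem ConsistentCone.star_eq_star_star (γ : ConsistentCone C) {b m d n : C} (e : γ.vertex ⟶ m)
    [Epi e] (f : m ⟶ d) [hf : Epi f] (e' : γ.vertex ⟶ n) [Epi e'] (h : n ⊑ b) (k : d ⊑ b)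
    (eq : e' ≫ incl h = e ≫ f ≫ incl k) : γ.star e' = @star C _ _ _ (γ.star e) d f hf :=
  (star_congr γ _ _ h k (by rw [eq, Category.assoc])).trans (ConsistentCone.star_star γ e f).symm

/-- Factor `w ≫ f` as a retraction `q` followed by a bimorphism. The retraction is absorbed into the
idempotent cone, which stays idempotent. -/
theorem star_mem_hat {γ : ConsistentCone C} (hγ : γ ∈ Hat C) {d : C} (f : γ.vertex ⟶ d) [i : Epi f] :
    γ.star f ∈ Hat C := by
  obtain ⟨ε, hε, c, w, hw, rfl⟩ := hγ
  have := hw.2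
  obtain ⟨n, e, h, ⟨m, q, b, ⟨k, hk⟩, hb, rfl⟩, hf⟩ :=
    HasConsistentFactorizations.factorization (w ≫ f)
  have hq : Epi q := IsRetraction.epi ⟨k, hk⟩
  have := hb.2
  refine ⟨ε.star q, idem_of_app_vertex ?_, n, b, hb, ?_⟩
  · change ε.app m ≫ q = 𝟙 m
    rw [← ε.incl_app k, app_vertex_of_idem hε, Category.comp_id, hk]
  · refine (ε.star_eq_star_star w f (hf := i) (q ≫ b) h (sub_refl d) ?_).symm.trans
      (ConsistentCone.star_star ε q b).symm
    refine hf.symm.trans ?_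
    rw [incl_refl]
    exact congrArg (w ≫ ·) (Category.comp_id f).symm

theorem mul_star_of_idem {ε : ConsistentCone C} (hε : IsIdempotentElem ε) {d : C}
    (e : ε.vertex ⟶ d) [Epi e] : ε * ε.star e = ε.star e := by
  refine star_congr ε (epiPart (ε.app ε.vertex ≫ e)) e (im_sub _) (sub_refl d) ?_
  rw [epiPart_incl, incl_refl, Category.comp_id, app_vertex_of_idem hε, Category.id_comp]

theorem mul_idem_of_vertex_sub {γ ε : ConsistentCone C} (hε : IsIdempotentElem ε)
    (h : γ.vertex ⊑ ε.vertex) : γ * ε = γ := by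
  refine (star_congr γ _ (𝟙 _) (im_sub _) h ?_).trans γ.star_id
  rw [epiPart_incl, Category.id_comp, ← ε.incl_app h, app_vertex_of_idem hε, Category.comp_id]

theorem mul_vertex_sub (γ δ : ConsistentCone C) : (γ * δ).vertex ⊑ δ.vertex := im_sub _

/-- Left multiplication of cones commutes with the action of the morphisms of `C`. This is the
naturality of `dualMap`. -/
theorem mul_star_epiPart (s x : ConsistentCone C) {c d : C} (g : c ⟶ d) (h : x.vertex ⊑ c)
    (h' : (s * x).vertex ⊑ c) :
    s * x.star (epiPart (incl h ≫ g)) = (s * x).star (epiPart (incl h' ≫ g)) := by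
  refine s.star_eq_star_star (epiPart (x.app s.vertex)) (epiPart (incl h' ≫ g))
    (hf := epiPart_epi _) (epiPart (x.app s.vertex ≫ epiPart (incl h ≫ g)))
    (sub_trans (im_sub _) (im_sub (incl h ≫ g))) (im_sub (incl h' ≫ g)) ?_
  rw [← incl_trans (im_sub _) (im_sub (incl h ≫ g)), ← Category.assoc, epiPart_incl]
  rw [Category.assoc, epiPart_incl]
  refine Eq.trans ?_ (congrArg (epiPart (x.app s.vertex) ≫ ·) (epiPart_incl (incl h' ≫ g)).symm)
  have key : ∀ k : im (x.app s.vertex) ⊑ c,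
      x.app s.vertex ≫ incl h ≫ g = epiPart (x.app s.vertex) ≫ incl k ≫ g := fun k => by
    rw [show incl k = incl (im_sub (x.app s.vertex)) ≫ incl h from (incl_trans _ h).symm,
      Category.assoc, ← Category.assoc (epiPart _), epiPart_incl]
  exact key h'

end Cones

section HFunctors

variable {C : Type u} [SmallCategory C] [CategoryWithSubobjects C] [HasConsistentFactorizations C]

theorem HSet.hom_eq {ε : ConsistentCone C} (hε : IsIdempotentElem ε) {c : C} (x : HSet ε c)
    (h : x.1.vertex ⊑ c) : HSet.hom x = x.1.app ε.vertex ≫ incl h := by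
  obtain ⟨f, rfl⟩ : ∃ f, x = HSet.mk ε f := ⟨_, (HSet.mk_hom x).symm⟩
  rw [HSet.hom_mk hε]
  change f = (ε.app ε.vertex ≫ epiPart f) ≫ incl _
  rw [app_vertex_of_idem hε, Category.id_comp, epiPart_incl]

/-- `H(ε; c)` consists of the elements of `εĈ` whose vertex is a subobject of `c`. -/
theorem mem_HSet {ε : ConsistentCone C} (hε : IsIdempotentElem ε) (h : ε ∈ Hat C) {c : C}
    {γ : ConsistentCone C} : γ ∈ HSet ε c ↔ γ ∈ Hat C ∧ ε * γ = γ ∧ γ.vertex ⊑ c := by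
  constructor
  · rintro ⟨f, rfl⟩
    exact ⟨star_mem_hat h _, mul_star_of_idem hε _, im_sub f⟩
  · rintro ⟨-, h1, h2⟩
    refine ⟨γ.app ε.vertex ≫ incl h2, h1.symm.trans ?_⟩
    refine star_congr ε _ _ (sub_trans (im_sub _) h2) (im_sub _) ?_
    rw [← incl_trans (im_sub _) h2, ← Category.assoc, epiPart_incl, epiPart_incl]

/-- The right-hand side does not involve `ε`, so all `H`-functors act by one formula and pointwise
inclusions are automatically natural. -/
theorem coe_H_map {ε : ConsistentCone C} (hε : IsIdempotentElem ε) {c d : C} (g : c ⟶ d)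
    (x : (H ε hε).obj c) (h : x.1.vertex ⊑ c) :
    ((H ε hε).map g x : ConsistentCone C) = x.1.star (epiPart (incl h ≫ g)) := by
  obtain ⟨f, rfl⟩ : ∃ f, x = HSet.mk ε f := ⟨_, (HSet.mk_hom x).symm⟩
  rw [H_map]
  refine ε.star_eq_star_star (epiPart f) (epiPart (incl h ≫ g)) (hf := epiPart_epi _) _
    (im_sub _) (im_sub (incl h ≫ g)) ?_
  rw [epiPart_incl]
  refine Eq.trans ?_ (congrArg (epiPart f ≫ ·) (epiPart_incl (incl h ≫ g)).symm)
  refine Eq.trans ?_ (Category.assoc _ _ _)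
  exact congrArg (· ≫ g) (epiPart_incl f).symm

theorem isSubfunctor_H_iff {ε ε' : ConsistentCone C} (hε : IsIdempotentElem ε)
    (hε' : IsIdempotentElem ε') (h : ε ∈ Hat C) (h' : ε' ∈ Hat C) :
    IsSubfunctor (H ε hε) (H ε' hε') ↔ ε' * ε = ε := by
  constructor
  · rintro ⟨k, -⟩
    -- The inclusion is tested on the element `ε` of `H(ε; c_ε)`.
    exact ((mem_HSet hε' h').1 (k ε.vertex ((mem_HSet hε h).2 ⟨h, hε, sub_refl _⟩))).2.1
  · intro k
    refine ⟨fun c x hx => ?_, fun {c d} f x => Subtype.ext ?_⟩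
    · obtain ⟨h1, h2, h3⟩ := (mem_HSet hε h).1 hx
      exact (mem_HSet hε' h').2 ⟨h1, by rw [← h2, ← mul_assoc, k], h3⟩
    · have hx := ((mem_HSet hε h).1 x.2).2.2
      exact (coe_H_map hε' f _ hx).trans (coe_H_map hε f x hx).symm

/-! ### The consistent dual -/

namespace ConsistentDual

theorem exists_eq_of (F : ConsistentDual C) :
    ∃ (ε : Hat C) (hε : IsIdempotentElem ε), F = of ε hε := by
  obtain ⟨F, ε, hε, h, rfl⟩ := F
  exact ⟨⟨ε, h⟩, Subtype.ext hε, rfl⟩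

theorem of_sub_of {ε ε' : Hat C} (hε : IsIdempotentElem ε) (hε' : IsIdempotentElem ε') :
    of ε hε ⊑ of ε' hε' ↔ RightIdeals.of ε hε ⊑ RightIdeals.of ε' hε' := by
  refine (isSubfunctor_H_iff (coe_idem hε) (coe_idem hε') ε.2 ε'.2).trans
    (Iff.trans ?_ (RightIdeals.of_subset_of hε hε').symm)
  exact ⟨fun h => Subtype.ext h, fun h => congrArg Subtype.val h⟩

theorem mem_of {ε : Hat C} (hε : IsIdempotentElem ε) {c : C} {γ : ConsistentCone C} :
    γ ∈ (of ε hε).functor.obj c ↔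
      ∃ h : γ ∈ Hat C, ⟨γ, h⟩ ∈ (RightIdeals.of ε hε).carrier ∧ γ.vertex ⊑ c := by
  refine (mem_HSet (coe_idem hε) ε.2).trans ⟨?_, ?_⟩
  · rintro ⟨h, h1, h2⟩
    exact ⟨h, (RightIdeals.mem_of hε).2 (Subtype.ext h1), h2⟩
  · rintro ⟨h, h1, h2⟩
    exact ⟨h, congrArg Subtype.val ((RightIdeals.mem_of hε).1 h1), h2⟩

theorem vertex_sub (F : ConsistentDual C) {c : C} (x : F.functor.obj c) : x.1.vertex ⊑ c := by
  obtain ⟨ε, hε, rfl⟩ := F.exists_eq_of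
  exact ((mem_of hε).1 x.2).choose_spec.2

theorem coe_map (F : ConsistentDual C) {c d : C} (g : c ⟶ d) (x : F.functor.obj c)
    (h : x.1.vertex ⊑ c) :
    (F.functor.map g x : ConsistentCone C) = x.1.star (epiPart (incl h ≫ g)) := by
  obtain ⟨ε, hε, rfl⟩ := F.exists_eq_of
  exact coe_H_map (coe_idem hε) g x h

/-- The components of a morphism of `C*`, as maps of sets. -/
def homApp {F F' : ConsistentDual C} (φ : F ⟶ F') (c : C) (x : F.functor.obj c) :
    F'.functor.obj c := NatTrans.app φ c x

theorem hom_ext {F F' : ConsistentDual C} {φ ψ : F ⟶ F'}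
    (h : ∀ c (x : F.functor.obj c), (homApp φ c x : ConsistentCone C) = homApp ψ c x) : φ = ψ := by
  refine NatTrans.ext (funext fun c => ?_)
  ext x
  exact Subtype.ext (h c x)

theorem homApp_naturality {F F' : ConsistentDual C} (φ : F ⟶ F') {c d : C} (g : c ⟶ d)
    (x : F.functor.obj c) : homApp φ d (F.functor.map g x) = F'.functor.map g (homApp φ c x) :=
  ConcreteCategory.congr_hom (NatTrans.naturality φ g) x

theorem coe_homApp_eqToHom {F F' : ConsistentDual C} (h : F = F') (c : C) (x : F.functor.obj c) :
    (homApp (eqToHom h) c x : ConsistentCone C) = x := by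
  obtain rfl := h
  rfl

end ConsistentDual

end HFunctors

/-! ### The functor `G`: construction, full faithfulness, uniqueness. -/

section DualFunctor

variable {C : Type u} [SmallCategory C] [CategoryWithSubobjects C] [HasConsistentFactorizations C]

/-- The object `H(ε; -)` of `C*`, as a function of the ideal `εĈ`. -/
noncomputable def RightIdeals.dual (A : RightIdeals (Hat C)) : ConsistentDual C :=
  ConsistentDual.of A.exists_eq_of.choose A.exists_eq_of.choose_spec.choose

/-- Independence of the chosen generator: inclusions between `H`-functors correspond to inclusions
between ideals, so equal ideals give equal functors. -/
theorem RightIdeals.dual_of (ε : Hat C) (hε : IsIdempotentElem ε) :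
    (of ε hε).dual = ConsistentDual.of ε hε := by
  have h := (of ε hε).exists_eq_of.choose_spec
  refine sub_antisymm ((ConsistentDual.of_sub_of _ _).2 ?_) ((ConsistentDual.of_sub_of _ _).2 ?_)
  · rw [← h.choose_spec]
    exact sub_refl _
  · rw [← h.choose_spec]
    exact sub_refl _

theorem RightIdeals.mem_dual {A : RightIdeals (Hat C)} {c : C} {γ : ConsistentCone C} :
    γ ∈ A.dual.functor.obj c ↔ ∃ h : γ ∈ Hat C, ⟨γ, h⟩ ∈ A.carrier ∧ γ.vertex ⊑ c := by
  obtain ⟨ε, hε, rfl⟩ := A.exists_eq_of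
  rw [dual_of]
  exact ConsistentDual.mem_of hε

theorem RightIdeals.dual_sub_dual {A B : RightIdeals (Hat C)} : A.dual ⊑ B.dual ↔ A ⊑ B := by
  obtain ⟨ε, hε, rfl⟩ := A.exists_eq_of
  obtain ⟨ε', hε', rfl⟩ := B.exists_eq_of
  rw [dual_of, dual_of]
  exact ConsistentDual.of_sub_of hε hε'

theorem RightIdeals.dual_bijective : Function.Bijective (RightIdeals.dual (C := C)) := by
  refine ⟨fun A B h => sub_antisymm ?_ ?_, fun F => ?_⟩
  · exact dual_sub_dual.1 (h ▸ sub_refl _)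
  · exact dual_sub_dual.1 (h ▸ sub_refl _)
  · obtain ⟨ε, hε, rfl⟩ := F.exists_eq_of
    exact ⟨of ε hε, dual_of ε hε⟩

/-- An element of `A.dual`, as an element of the ideal `A`. -/
def RightIdeals.ofDual {A : RightIdeals (Hat C)} {c : C} (x : A.dual.functor.obj c) : A.carrier :=
  ⟨⟨x, (mem_dual.1 x.2).choose⟩, (mem_dual.1 x.2).choose_spec.1⟩

theorem RightIdeals.hom_vertex_sub {A B : RightIdeals (Hat C)} (φ : A ⟶ B) (x : A.carrier) :
    (φ.1 x).1.1.vertex ⊑ x.1.1.vertex := by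
  obtain ⟨-, -, s, -, -, -, -, -, h⟩ := φ.2
  rw [h]
  exact mul_vertex_sub s.1 x.1.1

/-- The natural transformation `x ↦ φ x`. -/
def RightIdeals.dualMap {A B : RightIdeals (Hat C)} (φ : A ⟶ B) : A.dual ⟶ B.dual :=
  let app : ∀ c, A.dual.functor.obj c → B.dual.functor.obj c := fun c x =>
    ⟨(φ.1 (ofDual x)).1.1, mem_dual.2 ⟨(φ.1 (ofDual x)).1.2, (φ.1 (ofDual x)).2,
      sub_trans (hom_vertex_sub φ _) (A.dual.vertex_sub x)⟩⟩
  show A.dual.functor.toFunctor ⟶ B.dual.functor.toFunctor from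
  { app := fun c => TypeCat.ofHom (app c)
    naturality := fun c d g => by
      ext x
      have key : app d (A.dual.functor.map g x) = B.dual.functor.map g (app c x) := by
        refine Subtype.ext ?_
        obtain ⟨-, -, s, -, -, -, -, -, h⟩ := φ.2
        have happ : ∀ c x, (app c x).1 = s.1 * x.1 := fun c x => congrArg Subtype.val (h (ofDual x))
        have hx := A.dual.vertex_sub x
        have hx' : (s.1 * x.1).vertex ⊑ c := sub_trans (mul_vertex_sub _ _) hx
        have h1 : ∀ y : B.dual.functor.obj c, y.1 = s.1 * x.1 →
            (B.dual.functor.map g y).1 = (s.1 * x.1).star (epiPart (incl hx' ≫ g)) := by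
          intro y hy
          generalize s.1 * x.1 = z at hy hx'
          subst hy
          exact B.dual.coe_map g y hx'
        rw [happ, A.dual.coe_map g x hx, h1 _ (happ c x)]
        exact mul_star_epiPart s.1 x.1 g hx hx'
      exact key }

variable (C) in
/-- The functor `G : ℝ(Ĉ) ⥤ C*`. -/
noncomputable def dualFunctor : RightIdeals (Hat C) ⥤ ConsistentDual C where
  obj := RightIdeals.dual
  map := RightIdeals.dualMap
  map_id _ := ConsistentDual.hom_ext fun _ _ => rfl
  map_comp _ _ := ConsistentDual.hom_ext fun _ _ => rfl

-- Each `x` in the ideal occurs in the value of the functor at its own vertex, where the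
-- transformation returns `φ x`.
instance : (dualFunctor C).Faithful := ⟨fun {A B φ ψ} h => RightIdeals.hom_ext fun x => by
  have hx : x.1.1 ∈ A.dual.functor.obj x.1.1.vertex :=
    RightIdeals.mem_dual.2 ⟨x.1.2, x.2, sub_refl _⟩
  exact Subtype.ext (congrArg (fun θ => (ConsistentDual.homApp θ x.1.1.vertex ⟨x.1.1, hx⟩).1) h)⟩

/-- A Yoneda argument: `θ` is determined by `y = θ(ε)`, because each `x` is the image of `ε` under
the action of some `f`. Naturality then gives `θ(x) = y * x`, and `y * ε = y` since the vertex of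
`y` lies below `c_ε`. -/
theorem RightIdeals.dualMap_surjective {A B : RightIdeals (Hat C)} (θ : A.dual ⟶ B.dual) :
    ∃ φ : A ⟶ B, dualMap φ = θ := by
  obtain ⟨ε, hε, rfl⟩ := A.exists_eq_of
  obtain ⟨ε', hε', rfl⟩ := B.exists_eq_of
  have hmem : ε.1 ∈ (RightIdeals.of ε hε).dual.functor.obj ε.1.vertex :=
    RightIdeals.mem_dual.2 ⟨ε.2, RightIdeals.self_mem hε, sub_refl _⟩
  let e : (RightIdeals.of ε hε).dual.functor.obj ε.1.vertex := ⟨ε.1, hmem⟩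
  let y := ConsistentDual.homApp θ _ e
  obtain ⟨hγ, hγ', hv⟩ := RightIdeals.mem_dual.1 y.2
  let γ : Hat C := ⟨y.1, hγ⟩
  refine ⟨RightIdeals.leftMul hε hε' γ ((RightIdeals.mem_of hε').1 hγ')
    (Subtype.ext (mul_idem_of_vertex_sub (coe_idem hε) hv)), ConsistentDual.hom_ext fun c x => ?_⟩
  obtain ⟨hx, hxε, hxc⟩ := RightIdeals.mem_dual.1 x.2
  have hεx : ε.1 * x.1 = x.1 := congrArg Subtype.val ((RightIdeals.mem_of hε).1 hxε)
  let f : ε.1.vertex ⟶ c := x.1.app ε.1.vertex ≫ incl hxc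
  have hf : (RightIdeals.of ε hε).dual.functor.map f e = x := by
    refine Subtype.ext ?_
    rw [ConsistentDual.coe_map _ f e (sub_refl _)]
    refine Eq.trans ?_ hεx
    refine ConsistentCone.star_congr ε.1 (epiPart (incl (sub_refl _) ≫ f)) (epiPart (x.1.app ε.1.vertex))
      (im_sub _) (sub_trans (im_sub _) hxc) ?_
    rw [epiPart_incl, incl_refl, Category.id_comp, ← incl_trans (im_sub _) hxc, ← Category.assoc,
      epiPart_incl]
  have h1 : ConsistentDual.homApp θ c x = (RightIdeals.of ε' hε').dual.functor.map f y := by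
    rw [← hf]
    exact ConsistentDual.homApp_naturality θ f e
  rw [h1, ConsistentDual.coe_map _ f y hv]
  change y.1 * x.1 = _
  refine ConsistentCone.star_congr y.1 (epiPart (x.1.app y.1.vertex)) (epiPart (incl hv ≫ f))
    (sub_trans (im_sub _) hxc) (im_sub _) ?_
  rw [epiPart_incl, ← incl_trans (im_sub _) hxc, ← Category.assoc, epiPart_incl, ← Category.assoc,
    x.1.incl_app hv]

instance : (dualFunctor C).Full := ⟨fun θ => RightIdeals.dualMap_surjective θ⟩

theorem isCategoryIso_dualFunctor : IsCategoryIso (dualFunctor C) :=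
  isCategoryIso_of_bijective _ RightIdeals.dual_bijective

theorem preservesInclusions_dualFunctor : PreservesInclusions (dualFunctor C) := fun h =>
  ⟨RightIdeals.dual_sub_dual.2 h, ConsistentDual.hom_ext fun _ _ => rfl⟩

/-- This is the defining equation of `G(λ)`, read on elements. -/
theorem HSet.hom_of_eq_mul {ε ε' γ : Hat C} (hε : IsIdempotentElem ε) (hε' : IsIdempotentElem ε')
    (hγ : ∃ t, γ = ε' * t * ε) {c : C} (x : HSet (ε : ConsistentCone C) c)
    (y : HSet (ε' : ConsistentCone C) c) (h : y.1 = γ.1 * x.1) :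
    HSet.hom y = tilde hγ ≫ HSet.hom x := by
  have hx := ((mem_HSet (coe_idem hε) ε.2).1 x.2).2.2
  have hy := ((mem_HSet (coe_idem hε') ε'.2).1 y.2).2.2
  rw [HSet.hom_eq (coe_idem hε) x hx, HSet.hom_eq (coe_idem hε') y hy]
  have h1 : ∀ z : ConsistentCone C, z = γ.1 * x.1 → ∀ k : z.vertex ⊑ c, z.app ε'.1.vertex ≫ incl k =
      γ.1.app ε'.1.vertex ≫ x.1.app γ.1.vertex ≫ incl hx := by
    rintro _ rfl k
    have key : ∀ l : im (x.1.app γ.1.vertex) ⊑ c,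
        (γ.1.app ε'.1.vertex ≫ epiPart (x.1.app γ.1.vertex)) ≫ incl l =
          γ.1.app ε'.1.vertex ≫ x.1.app γ.1.vertex ≫ incl hx := fun l => by
      rw [← incl_trans (im_sub _) hx, Category.assoc, ← Category.assoc (epiPart _), epiPart_incl]
    exact key k
  rw [h1 y.1 h hy, tilde, Category.assoc, ← Category.assoc (incl _), x.1.incl_app]

theorem isDualFunctor_dualFunctor : IsDualFunctor (dualFunctor C) where
  obj_of := RightIdeals.dual_of
  map_lam {ε ε'} hε hε' γ hγ := by
    ext c x
    refine HSet.hom_of_eq_mul hε hε' hγ x _ ?_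
    refine (ConsistentDual.coe_homApp_eqToHom (RightIdeals.dual_of ε' hε') c _).trans ?_
    refine congrArg (γ.1 * ·) ?_
    exact ConsistentDual.coe_homApp_eqToHom (RightIdeals.dual_of ε hε).symm c x

instance : (ConsistentDual.toFunctor C).Faithful := ⟨fun h => h⟩

instance : (ConsistentDual.toFunctor C).Full := ⟨fun φ => ⟨φ, rfl⟩⟩

/-- Every morphism of `ℝ(Ĉ)` is some `λ(ε, γ, ε')`, and its image is determined since `eta` is
invertible. -/
theorem IsDualFunctor.unique {G G' : RightIdeals (Hat C) ⥤ ConsistentDual C} (hG : IsDualFunctor G)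
    (hG' : IsDualFunctor G') : G = G' := by
  have hobj : ∀ A, G.obj A = G'.obj A := fun A => by
    obtain ⟨ε, hε, rfl⟩ := A.exists_eq_of
    rw [hG.obj_of, hG'.obj_of]
  refine CategoryTheory.Functor.ext hobj fun A B φ => ?_
  obtain ⟨A, hA⟩ := A
  obtain ⟨B, hB⟩ := B
  obtain ⟨φ, hφ⟩ := φ
  obtain ⟨ε, ε', γ, hε, hε', h1, h2, hγ, h⟩ := hφ
  dsimp only at h1 h2
  subst h1 h2
  obtain rfl : φ = (RightIdeals.lam hε hε' γ hγ).1 := funext fun x => Subtype.ext (h x)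
  have key := (ConsistentDual.toFunctor C).map_injective ((cancel_mono (eta ε'.1 _).hom).1
    ((hG.map_lam hε hε' γ hγ).trans (hG'.map_lam hε hε' γ hγ).symm))
  have h1 := congrArg (fun t => eqToHom (hG.obj_of ε hε) ≫ t ≫ eqToHom (hG.obj_of ε' hε').symm) key
  simp only [Category.assoc, eqToHom_trans, eqToHom_trans_assoc, eqToHom_refl, Category.comp_id,
    Category.id_comp] at h1
  exact h1

end DualFunctor

/-! ### Transport of inclusions, cones and consistency along isomorphisms. -/

section Isomorphisms

variable {A B : Type*} [Category A] [Category B] [CategoryWithSubobjects A]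
  [CategoryWithSubobjects B]

theorem IsCategoryIso.isConsistentIso {F : A ⥤ B} (hF : IsCategoryIso F)
    (hincl : PreservesInclusions F) (hsub : ∀ {a b : A}, F.obj a ⊑ F.obj b → a ⊑ b) :
    IsConsistentIso F := by
  obtain ⟨K, h, k⟩ := hF
  refine ⟨hincl, K, h, k, fun {x y} l => ?_⟩
  obtain ⟨a, rfl⟩ : ∃ a, F.obj a = x := ⟨_, Functor.congr_obj k x⟩
  obtain ⟨b, rfl⟩ : ∃ b, F.obj b = y := ⟨_, Functor.congr_obj k y⟩
  obtain ⟨m, hm⟩ := hincl (hsub l)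
  have key : ∀ L : A ⥤ A, L = 𝟭 A →
      ∃ n : L.obj a ⊑ L.obj b, L.map (incl (hsub l)) = incl n := by
    rintro _ rfl
    exact ⟨hsub l, rfl⟩
  obtain ⟨n, hn⟩ := key _ h
  refine ⟨n, ?_⟩
  rw [← hn, Functor.comp_map, hm]

theorem exists_cone_of_isCategoryIso {F : A ⥤ B} (hF : IsCategoryIso F)
    (hincl : PreservesInclusions F) (hsub : ∀ {a b : A}, F.obj a ⊑ F.obj b → a ⊑ b)
    (hA : ∀ c : A, ∃ ε : ConsistentCone A, ∃ h : ε.vertex = c, ε.app c ≫ eqToHom h = 𝟙 c)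
    (c : B) : ∃ ε : ConsistentCone B, ∃ h : ε.vertex = c, ε.app c ≫ eqToHom h = 𝟙 c := by
  have := hF.isEquivalence
  obtain ⟨c, rfl⟩ := hF.bijective_obj.2 c
  obtain ⟨ε, rfl, hε⟩ := hA c
  rw [eqToHom_refl, Category.comp_id] at hε
  choose g hg using hF.bijective_obj.2
  let app : ∀ b : B, b ⟶ F.obj ε.vertex := fun b => eqToHom (hg b).symm ≫ F.map (ε.app (g b))
  -- The chosen preimage of `F.obj a` equals `a` only propositionally, so the `eqToHom` is removed
  -- by generalising over it.
  have happ : ∀ a, app (F.obj a) = F.map (ε.app a) := fun a => by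
    have key : ∀ a' (h : F.obj a = F.obj a'), a = a' →
        eqToHom h ≫ F.map (ε.app a') = F.map (ε.app a) := by
      rintro _ h rfl
      rw [eqToHom_refl, Category.id_comp]
    exact key _ _ (hF.bijective_obj.1 (hg _)).symm
  refine ⟨⟨F.obj ε.vertex, app, fun {x y} h => ?_, F.obj ε.vertex, ?_⟩, rfl, ?_⟩
  · obtain ⟨a, rfl⟩ := hF.bijective_obj.2 x
    obtain ⟨b, rfl⟩ := hF.bijective_obj.2 y
    obtain ⟨k, hk⟩ := hincl (hsub h)
    rw [happ, happ, ← ε.incl_app (hsub h), F.map_comp, hk]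
  · rw [happ, hε, F.map_id]
    exact ⟨inferInstance, inferInstance⟩
  · change app _ ≫ 𝟙 _ = _
    rw [Category.comp_id, happ, hε, F.map_id]

/-- Consistency is transported along isomorphisms of categories which preserve and reflect
inclusions. -/
theorem SplitConsistent.consistentCategory_of_iso (hB : SplitConsistent B) [ConsistentCategory A]
    {F : A ⥤ B} (hF : IsCategoryIso F) (hincl : PreservesInclusions F)
    (hsub : ∀ {a b : A}, F.obj a ⊑ F.obj b → a ⊑ b) : ConsistentCategory B := by
  have := hF.isEquivalence
  refine hB.consistentCategory (fun {x y} h => ?_) (fun {x y} s hs => ?_)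
    (exists_cone_of_isCategoryIso hF hincl hsub ConsistentCategory.exists_cone)
  · obtain ⟨a, rfl⟩ := hF.bijective_obj.2 x
    obtain ⟨b, rfl⟩ := hF.bijective_obj.2 y
    obtain ⟨k, hk⟩ := hincl (hsub h)
    obtain ⟨q, hq⟩ := HasConsistentFactorizations.incl_splits (hsub h)
    exact ⟨F.map q, by rw [← hk, ← F.map_comp, hq, F.map_id]⟩
  · obtain ⟨a, rfl⟩ := hF.bijective_obj.2 x
    obtain ⟨b, rfl⟩ := hF.bijective_obj.2 y
    obtain ⟨s, rfl⟩ := F.map_surjective s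
    have := (F.isSplitMono_iff s).1 hs
    obtain ⟨n, w, h, rfl⟩ := exists_iso_incl s
    obtain ⟨k, hk⟩ := hincl h
    exact ⟨F.obj n, F.mapIso w, k, by rw [F.map_comp, hk, Functor.mapIso_hom]⟩

end Isomorphisms

/-! ### The equivalence of `C*` with `Cᵒᵖ` and the conclusion. -/

section Main

variable (C : Type u) [SmallCategory C] [CategoryWithSubobjects C] [ConsistentCategory C]

theorem ConsistentDual.mem_essImage_coyoneda (F : ConsistentDual C) :
    (coyoneda (C := C)).essImage ((ConsistentDual.toFunctor C).obj F) := by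
  obtain ⟨ε, hε, rfl⟩ := F.exists_eq_of
  exact ⟨_, ⟨(eta (ε : ConsistentCone C) (coe_idem hε)).symm⟩⟩

/-- The functor `C* ⥤ Cᵒᵖ` which sends `H(ε; -)` to `c_ε`, up to isomorphism. -/
noncomputable def ConsistentDual.toOp : ConsistentDual C ⥤ Cᵒᵖ :=
  Functor.essImage.liftFunctor (ConsistentDual.toFunctor C) coyoneda
    (ConsistentDual.mem_essImage_coyoneda C)

/-- The composite of `C* ⥤ Cᵒᵖ` with the Yoneda embedding is the inclusion functor of `C*`. -/
noncomputable def ConsistentDual.toOpCompCoyoneda :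
    ConsistentDual.toOp C ⋙ coyoneda ≅ ConsistentDual.toFunctor C :=
  Functor.essImage.liftFunctorCompIso _ _ _

instance : (ConsistentDual.toOp C).IsEquivalence where
  faithful :=
    have : (ConsistentDual.toOp C ⋙ coyoneda).Faithful :=
      Functor.Faithful.of_iso (ConsistentDual.toOpCompCoyoneda C).symm
    Functor.Faithful.of_comp _ coyoneda
  full :=
    have : (ConsistentDual.toOp C ⋙ coyoneda).Full :=
      Functor.Full.of_iso (ConsistentDual.toOpCompCoyoneda C).symm
    Functor.Full.of_comp_faithful _ coyoneda
  essSurj := ⟨fun c => by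
    obtain ⟨ε, h, hε⟩ := ConsistentCategory.exists_cone c.unop
    obtain ⟨c⟩ := c
    dsimp only at h
    subst h
    rw [eqToHom_refl, Category.comp_id] at hε
    -- The cone axiom makes every object the vertex of an idempotent cone, which lies in `Ĉ` as `ε ∗
    -- 1`.
    have hidem : IsIdempotentElem ε := ConsistentCone.idem_of_app_vertex hε
    have hhat : ε ∈ Hat C := ⟨ε, hidem, ε.vertex, 𝟙 _, ⟨inferInstance, inferInstance⟩,
      ε.star_id.symm⟩
    exact ⟨ConsistentDual.of ⟨ε, hhat⟩ (Subtype.ext hidem), ⟨coyoneda.preimageIso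
      ((ConsistentDual.toOpCompCoyoneda C).app _ ≪≫ eta ε hidem)⟩⟩⟩

theorem splitConsistent_dual : SplitConsistent (ConsistentDual C) :=
  (splitConsistent C).op.of_isEquivalence (ConsistentDual.toOp C)

/-- Only the inclusion-free layer is taken from `C*`; the rest holds for any semigroup. -/
theorem consistentCategory_rightIdeals : ConsistentCategory (RightIdeals (Hat C)) := by
  have := (isCategoryIso_dualFunctor (C := C)).isEquivalence
  exact ((splitConsistent_dual C).of_isEquivalence (dualFunctor C)).consistentCategory
    RightIdeals.incl_splits RightIdeals.exists_iso_incl RightIdeals.exists_cone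

end Main

end CategoryWithSubobjects

theorem mainTheorem11 (C : Type u) [SmallCategory C] [CategoryWithSubobjects C]
    [ConsistentCategory C] :
    ConsistentCategory (RightIdeals (Hat C)) ∧
      (∃! G : RightIdeals (Hat C) ⥤ ConsistentDual C, IsDualFunctor G) ∧
      (∀ G : RightIdeals (Hat C) ⥤ ConsistentDual C, IsDualFunctor G → IsConsistentIso G) ∧
      ConsistentCategory (ConsistentDual C) := by
  have hR := consistentCategory_rightIdeals C
  refine ⟨hR, ⟨dualFunctor C, isDualFunctor_dualFunctor,
    fun G hG => hG.unique isDualFunctor_dualFunctor⟩, fun G hG => ?_, ?_⟩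
  · obtain rfl := hG.unique isDualFunctor_dualFunctor
    exact isCategoryIso_dualFunctor.isConsistentIso preservesInclusions_dualFunctor
      RightIdeals.dual_sub_dual.1
  · exact (splitConsistent_dual C).consistentCategory_of_iso isCategoryIso_dualFunctor
      preservesInclusions_dualFunctor RightIdeals.dual_sub_dual.1
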